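/- **Conventions.** Algebras are nonempty. For an algebra $A$, $\operatorname{Con}A$ is its congruence lattice, $\operatorname{Con_c}A$ the $(\vee,0)$-semilattice of its compact (that is, finitely generated) congruences, and $\Theta_A(x,y)$ the least congruence identifying $x$ and $y$; a homomorphism $f\colon A\to B$ induces the $(\vee,0)$-homomorphism $\operatorname{Con_c}f$ that sends $\theta$ to the congruence of $B$ generated by the image of $\theta$. For a variety $\mathcal V$, $\operatorname{Con_c}\mathcal V$ is the class of all semilattices isomorphic to $\operatorname{Con_c}A$ for some $A\in\mathcal V$. The critical point $\operatorname{crit}(\mathcal V;\mathcal W)$ is the least cardinality of a member of $(\operatorname{Con_c}\mathcal V)\setminus(\operatorname{Con_c}\mathcal W)$, and $\infty$ if there is none. A poset is a *lower finite tree* if each of its principal lower sets is a finite chain. "Countable" means at most countable. A diagram indexed by a poset is a functor from that poset. **Gamps.** A *partial algebra* is a set $A$ with partial operations $\ell\colon \operatorname{Def}_\ell(A)\to A$, $\operatorname{Def}_\ell(A)\subseteq A^{\operatorname{ar}(\ell)}$; it *satisfies* an identity $t_1=t_2$ if $t_1(\vec x)=t_2(\vec x)$ whenever both sides are defined. A morphism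 $f\colon A\to B$ of partial algebras is a map such that $\vec x\in\operatorname{Def}_\ell(A)$ implies $f(\vec x)\in\operatorname{Def}_\ell(B)$ and $f(\ell(\vec x))=\ell(f(\vec x))$. A *partial subalgebra* of $A$ is a subset $B$ that is a partial algebra with $\operatorname{Def}_\ell(B)\subseteq\operatorname{Def}_\ell(A)$ and with the restricted operations; it is *strong* if $B^{\operatorname{ar}(\ell)}\subseteq\operatorname{Def}_\ell(A)$ for all $\ell$. For a morphism $f$ and a partial subalgebra $X$ of its domain, $f(X)$ carries the domains $f(\operatorname{Def}_\ell(X))$. A *gamp of $\mathcal W$* is a quadruple $\mathbf B=(B^*,B,\delta,\widetilde B)$ where $B$ is a partial algebra, $B^*$ a partial subalgebra of $B$, $\widetilde B$ a $(\vee,0)$-semilattice, and $\delta\colon B^2\to\widetilde B$ satisfies $\delta(x,y)=0\iff x=y$, $\delta(x,y)=\delta(y,x)$, $\delta(x,y)\le\delta(x,z)\vee\delta(z,y)$ and $\delta(\ell(\vec x),\ell(\vec y))\le\bigvee_k\delta(x_k,y_k)$ for all $\vec x,\vec y\in\operatorname{Def}_\ell(B)$; moreover, for each ideal $I$ of $\widetilde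 B$, the quotient partial algebra $B/I$ of $B$ by the equivalence $\delta(x,y)\in I$ (with $\operatorname{Def}_\ell(B/I)$ the image of $\operatorname{Def}_\ell(B)$) satisfies all identities of $\mathcal W$. A *morphism* $\mathbf A\to\mathbf B$ is a pair $(f,\widetilde f)$ of a morphism $f\colon A\to B$ of partial algebras and a $(\vee,0)$-homomorphism $\widetilde f\colon\widetilde A\to\widetilde B$ with $\delta(f(x),f(y))=\widetilde f(\delta(x,y))$ and such that $f(A^*)$ is a partial subalgebra of $B^*$. The assignment $\mathbf B\mapsto\widetilde B$, $(f,\widetilde f)\mapsto\widetilde f$ is a functor $C_g$. A gamp $\mathbf B$ is *strong* if $B^*$ is a strong partial subalgebra of $B$; *distance-generated* if every element of $\widetilde B$ is a finite join of elements $\delta(x,y)$ with $x,y\in B^*$; *congruence-tractable* if whenever $x,y,x_k,y_k\in B^*$ and $\delta(x,y)\le\bigvee_{k<m}\delta(x_k,y_k)$, there are $n\ge1$, a finite list $\vec z$ in $B$ and terms $t_0,\dots,t_n$ such that in $B$ (everything being defined) $x=t_0(\vec x,\vec y,\vec z)$, $y=t_n(\vec x,\vec y,\vec z)$ and $t_k(\vec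 y,\vec x,\vec z)=t_{k+1}(\vec x,\vec y,\vec z)$ for $k<n$. It has an *isomorphic realization* if there are $B'\in\mathcal W$ having $B$ as a partial subalgebra and an isomorphism $\chi\colon\widetilde B\to\operatorname{Con_c}B'$ with $\chi(\delta(x,y))=\Theta_{B'}(x,y)$ for all $x,y\in B$. A morphism $(f,\widetilde f)\colon\mathbf A\to\mathbf B$ is *strong* if $f(A)$ is a strong partial subalgebra of $B^*$, and *congruence-cuttable* if $f(A)$ is a partial subalgebra of $B^*$ and, for every finite $X\subseteq\widetilde B$ and all $x,y\in A$ with $\delta(f(x),f(y))\le\bigvee X$, there are $n<\omega$ and $f(x)=x_0,\dots,x_n=f(y)$ in $B^*$ such that each $\delta(x_k,x_{k+1})$, $k<n$, lies below some element of $X$. A *partial lifting* in $\mathcal W$ of a $P$-indexed diagram $\vec S$ of $(\vee,0)$-semilattices is a $P$-indexed diagram $\vec{\mathbf B}$ of gamps of $\mathcal W$ such that every $\mathbf B_p$ is strong, congruence-tractable, distance-generated and has an isomorphic realization, the morphism $\mathbf B_p\to\mathbf B_q$ is strong and congruence-cuttable for all $p<q$, and $C_g\circ\vec{\mathbf B}\cong\vec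 S$. **Theorem.** Let $\mathcal V$ be a locally finite variety of algebras and let $\mathcal W$ be a variety of algebras with finite similarity type (the similarity types of $\mathcal V$ and $\mathcal W$ may differ). The following statements are equivalent: 1. $\operatorname{crit}(\mathcal V;\mathcal W)>\aleph_0$. 2. For every countable lower finite tree $T$ and every $T$-indexed diagram $\vec A$ of finite algebras in $\mathcal V$, the diagram $\operatorname{Con_c}\circ\vec A$ has a partial lifting in $\mathcal W$. 3. For every $\omega$-indexed diagram $\vec A$ of finite algebras in $\mathcal V$, the diagram $\operatorname{Con_c}\circ\vec A$ has a partial lifting in $\mathcal W$. -/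

import Mathlib

open CategoryTheory
open scoped FirstOrder

universe u v w

namespace UA

/-! ### Congruences of algebras

A similarity type is a `FirstOrder.Language` without relation symbols, and an algebra of that type
is a structure for it. -/

section Congruences

variable (L : FirstOrder.Language.{u, u}) (A : Type u) [L.Structure A]

/-- A congruence: an equivalence relation compatible with all the operations. -/
@[ext]
structure AlgCon extends Setoid A where
  map_rel : ∀ {n : ℕ} (f : L.Functions n) (x y : Fin n → A), (∀ i, r (x i) (y i)) →
    r (FirstOrder.Language.Structure.funMap f x) (FirstOrder.Language.Structure.funMap f y)

namespace AlgCon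

variable {L A}

theorem r_injective {θ ψ : AlgCon L A} (h : θ.r = ψ.r) : θ = ψ := by
  apply AlgCon.ext
  exact h

/-- Congruences are ordered by inclusion. -/
instance : PartialOrder (AlgCon L A) where
  le θ ψ := ∀ x y, θ.r x y → ψ.r x y
  le_refl _ _ _ h := h
  le_trans _ _ _ h₁ h₂ x y h := h₂ x y (h₁ x y h)
  le_antisymm θ ψ h₁ h₂ := r_injective (by
    funext x y
    exact propext ⟨h₁ x y, h₂ x y⟩)

/-- The intersection of a set of congruences. -/
instance : InfSet (AlgCon L A) where
  sInf s :=
    { r := fun x y => ∀ θ ∈ s, θ.r x y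
      iseqv := ⟨fun x θ _ => θ.iseqv.refl x, fun h θ hθ => θ.iseqv.symm (h θ hθ),
        fun h₁ h₂ θ hθ => θ.iseqv.trans (h₁ θ hθ) (h₂ θ hθ)⟩
      map_rel := fun f x y h θ hθ => θ.map_rel f x y fun i => h i θ hθ }

/-- The complete lattice `Con A` of all congruences of `A`. -/
instance : CompleteLattice (AlgCon L A) :=
  completeLatticeOfInf (AlgCon L A) fun _ =>
    ⟨fun _ hθ _ _ h => h _ hθ, fun _ hψ x y h _ hθ => hψ hθ x y h⟩

/-- The least congruence that contains a given relation. -/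
def gen (r : A → A → Prop) : AlgCon L A :=
  sInf {θ | ∀ x y, r x y → θ.r x y}

theorem gen_le {r : A → A → Prop} {θ : AlgCon L A} :
    gen r ≤ θ ↔ ∀ x y, r x y → θ.r x y :=
  ⟨fun h x y hr => h x y fun _ hψ => hψ x y hr, fun h => sInf_le h⟩

/-- The union of a nonempty directed set of congruences is its supremum. -/
theorem sSup_r_of_directed {s : Set (AlgCon L A)} (hs : s.Nonempty)
    (hd : DirectedOn (· ≤ ·) s) {x y : A} (h : (sSup s).r x y) : ∃ θ ∈ s, θ.r x y := by
  have key : ∀ (n : ℕ) (p q : Fin n → A), (∀ i, ∃ θ ∈ s, θ.r (p i) (q i)) →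
      ∃ θ ∈ s, ∀ i, θ.r (p i) (q i) := by
    intro n
    induction n with
    | zero => exact fun _ _ _ => ⟨hs.some, hs.some_mem, fun i => i.elim0⟩
    | succ n ih =>
      intro p q hpq
      obtain ⟨θ, hθ, h₀⟩ := hpq 0
      obtain ⟨ψ, hψ, h₁⟩ := ih (fun i => p i.succ) (fun i => q i.succ) fun i => hpq i.succ
      obtain ⟨χ, hχ, hle₀, hle₁⟩ := hd θ hθ ψ hψ
      exact ⟨χ, hχ, Fin.cases (hle₀ _ _ h₀) fun i => hle₁ _ _ (h₁ i)⟩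
  let U : AlgCon L A :=
    { r := fun x y => ∃ θ ∈ s, θ.r x y
      iseqv := by
        refine ⟨fun x => ?_, ?_, ?_⟩
        · obtain ⟨θ, hθ⟩ := hs
          exact ⟨θ, hθ, θ.iseqv.refl x⟩
        · rintro x y ⟨θ, hθ, hxy⟩
          exact ⟨θ, hθ, θ.iseqv.symm hxy⟩
        · rintro x y z ⟨θ, hθ, hxy⟩ ⟨ψ, hψ, hyz⟩
          obtain ⟨χ, hχ, h₁, h₂⟩ := hd θ hθ ψ hψ
          exact ⟨χ, hχ, χ.iseqv.trans (h₁ _ _ hxy) (h₂ _ _ hyz)⟩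
      map_rel := by
        intro n f p q hpq
        obtain ⟨θ, hθ, hr⟩ := key n p q hpq
        exact ⟨θ, hθ, θ.map_rel f p q hr⟩ }
  have hU : sSup s ≤ U := sSup_le fun θ hθ x y hxy => ⟨θ, hθ, hxy⟩
  exact hU x y h

/-- `Θ_A(x, y)`, the least congruence that identifies `x` and `y`. -/
def principal (x y : A) : AlgCon L A :=
  gen fun a b => a = x ∧ b = y

theorem principal_le {x y : A} {θ : AlgCon L A} : principal x y ≤ θ ↔ θ.r x y :=
  gen_le.trans ⟨fun h => h x y ⟨rfl, rfl⟩, by rintro h _ _ ⟨rfl, rfl⟩; exact h⟩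

theorem isCompactElement_principal (x y : A) :
    IsCompactElement (principal x y : AlgCon L A) := by
  rw [CompleteLattice.isCompactElement_iff_le_of_directed_sSup_le]
  intro s hs hd h
  obtain ⟨θ, hθ, hr⟩ := sSup_r_of_directed hs hd (principal_le.1 h)
  exact ⟨θ, hθ, principal_le.2 hr⟩

theorem isCompactElement_bot : IsCompactElement (⊥ : AlgCon L A) :=
  fun _ _ hs _ _ _ => ⟨hs.some, hs.some_mem, bot_le⟩

theorem isCompactElement_sup {θ ψ : AlgCon L A} (hθ : IsCompactElement θ)
    (hψ : IsCompactElement ψ) : IsCompactElement (θ ⊔ ψ) := by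
  intro s t hs hd hl h
  obtain ⟨a, ha, hθa⟩ := hθ s t hs hd hl (le_sup_left.trans h)
  obtain ⟨b, hb, hψb⟩ := hψ s t hs hd hl (le_sup_right.trans h)
  obtain ⟨c, hc, hac, hbc⟩ := hd a ha b hb
  exact ⟨c, hc, sup_le (hθa.trans hac) (hψb.trans hbc)⟩

variable {B : Type u} [L.Structure B]

/-- The inverse image of a congruence under a homomorphism. -/
def comap (f : A →[L] B) (ψ : AlgCon L B) : AlgCon L A where
  r x y := ψ.r (f x) (f y)
  iseqv := ⟨fun _ => ψ.iseqv.refl _, fun h => ψ.iseqv.symm h, fun h₁ h₂ => ψ.iseqv.trans h₁ h₂⟩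
  map_rel g x y h := by
    rw [f.map_fun, f.map_fun]
    exact ψ.map_rel g _ _ h

/-- The congruence of `B` generated by the image of a congruence of `A`. -/
def map (f : A →[L] B) (θ : AlgCon L A) : AlgCon L B :=
  gen fun b b' => ∃ a a', θ.r a a' ∧ f a = b ∧ f a' = b'

theorem gc_map_comap (f : A →[L] B) :
    GaloisConnection (map f : AlgCon L A → AlgCon L B) (comap f) := by
  intro θ ψ
  refine gen_le.trans ⟨fun h x y hxy => h _ _ ⟨x, y, hxy, rfl, rfl⟩, ?_⟩
  rintro h _ _ ⟨a, a', haa, rfl, rfl⟩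
  exact h a a' haa

theorem isCompactElement_map (f : A →[L] B) {θ : AlgCon L A} (hθ : IsCompactElement θ) :
    IsCompactElement (map f θ) := by
  rw [CompleteLattice.isCompactElement_iff_le_of_directed_sSup_le] at hθ ⊢
  intro s hs hd h
  have h' : θ ≤ sSup (comap f '' s) := by
    intro x y hxy
    obtain ⟨ψ, hψ, hr⟩ := sSup_r_of_directed hs hd ((gc_map_comap f θ _).1 h x y hxy)
    exact le_sSup (Set.mem_image_of_mem (comap f) hψ) x y hr
  obtain ⟨_, ⟨ψ, hψ, rfl⟩, hle⟩ := hθ _ (hs.image _) (by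
    rintro _ ⟨ψ₁, h₁, rfl⟩ _ ⟨ψ₂, h₂, rfl⟩
    obtain ⟨ψ, hψ, hle₁, hle₂⟩ := hd ψ₁ h₁ ψ₂ h₂
    exact ⟨_, ⟨ψ, hψ, rfl⟩, (gc_map_comap f).monotone_u hle₁,
      (gc_map_comap f).monotone_u hle₂⟩) h'
  exact ⟨ψ, hψ, (gc_map_comap f θ ψ).2 hle⟩

end AlgCon

/-- `Con_c A`, the compact congruences of `A`. -/
def Conc : Type u :=
  {θ : AlgCon L A // IsCompactElement θ}

instance : SemilatticeSup (Conc L A) :=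
  Subtype.semilatticeSup fun _ _ hθ hψ => AlgCon.isCompactElement_sup hθ hψ

instance : OrderBot (Conc L A) :=
  Subtype.orderBot AlgCon.isCompactElement_bot

variable {A}

/-- The distance `Θ_A : A × A → Con_c A`. -/
def theta (x y : A) : Conc L A :=
  ⟨AlgCon.principal x y, AlgCon.isCompactElement_principal x y⟩

variable {L} {B : Type u} [L.Structure B]

/-- `Con_c f` maps a compact congruence to the congruence generated by its image. -/
def Conc.map (f : A →[L] B) : SupBotHom (Conc L A) (Conc L B) where
  toFun θ := ⟨AlgCon.map f θ.1, AlgCon.isCompactElement_map f θ.2⟩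
  map_sup' _ _ := Subtype.ext (AlgCon.gc_map_comap f).l_sup
  map_bot' := Subtype.ext (AlgCon.gc_map_comap f).l_bot

end Congruences

/-! ### Varieties -/

section Varieties

variable {L : FirstOrder.Language.{u, u}}

/-- An identity `t₁ = t₂` in the variables `x₀, x₁, …`. -/
abbrev Identity (L : FirstOrder.Language.{u, u}) : Type u :=
  L.Term ℕ × L.Term ℕ

/-- A variety, given by a set of defining identities. -/
abbrev Variety (L : FirstOrder.Language.{u, u}) : Type u :=
  Set (Identity L)

/-- The algebra `A` satisfies the identity `e`. -/
def Satisfies (A : Type u) [L.Structure A] (e : Identity L) : Prop :=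
  ∀ v : ℕ → A, e.1.realize v = e.2.realize v

/-- The members of a variety; as usual, algebras are nonempty. -/
structure Alg (V : Variety L) : Type (u + 1) where
  carrier : Type u
  [str : L.Structure carrier]
  [nonempty : Nonempty carrier]
  satisfies : ∀ e ∈ V, Satisfies carrier e

attribute [instance] Alg.str Alg.nonempty

instance (V : Variety L) : CoeSort (Alg V) (Type u) :=
  ⟨Alg.carrier⟩

/-- A variety as a category: the arrows are the homomorphisms. -/
instance (V : Variety L) : Category.{u} (Alg V) where
  Hom A B := A.carrier →[L] B.carrier
  id A := FirstOrder.Language.Hom.id L A.carrier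
  comp f g := FirstOrder.Language.Hom.comp g f

/-- The functor `Con_c` from a variety to the category of `(∨, 0)`-semilattices. -/
def concFunctor (V : Variety L) : Alg V ⥤ SemilatSupCat.{u} where
  obj A := SemilatSupCat.of (Conc L A.carrier)
  map f := Conc.map f
  map_id A := by
    apply SupBotHom.ext
    intro θ
    apply Subtype.ext
    refine le_antisymm (AlgCon.gen_le.2 ?_) ?_
    · rintro _ _ ⟨a, a', h, rfl, rfl⟩
      exact h
    · exact (AlgCon.gc_map_comap (FirstOrder.Language.Hom.id L A.carrier)).le_u_l θ.1
  map_comp {A B C} f g := by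
    apply SupBotHom.ext
    intro θ
    apply Subtype.ext
    exact (AlgCon.gc_map_comap (FirstOrder.Language.Hom.comp g f)).l_unique
      ((AlgCon.gc_map_comap f).compose (AlgCon.gc_map_comap g)) (fun _ => rfl)

/-- All the identities that hold in the variety. -/
def identitiesOf (V : Variety L) : Set (Identity L) :=
  {e | ∀ A : Alg V, Satisfies A.carrier e}

/-- A variety is locally finite if its finitely generated members are finite; equivalently, all
finitely generated subalgebras of its members are finite. -/
def IsLocallyFinite (V : Variety L) : Prop :=
  ∀ (A : Alg V) (N : L.Substructure A.carrier), N.FG → Finite N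

/-- `Con_c V`: the semilattices isomorphic to `Con_c A` for some `A ∈ V`. -/
def concClass (V : Variety L) : Set SemilatSupCat.{u} :=
  {S | ∃ A : Alg V, Nonempty ((concFunctor V).obj A ≅ S)}

/-- The critical point `crit(V; W)`: the least cardinality of a semilattice in
`(Con_c V) - (Con_c W)`, and `⊤` (that is, `∞`) if there is none. -/
noncomputable def crit {L₁ L₂ : FirstOrder.Language.{u, u}} (V : Variety L₁) (W : Variety L₂) :
    WithTop Cardinal.{u} :=
  sInf {c | ∃ S ∈ concClass V \ concClass W, c = ((Cardinal.mk S : Cardinal.{u}) : WithTop _)}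

end Varieties

/-! ### Partial algebras -/

section PartialAlgebras

/-- A partial algebra. The partial operations are given by their graphs: `op f x a` says that
`x ∈ Def_f(A)` and `f(x) = a`. -/
class PartialAlgebra (L : FirstOrder.Language.{u, u}) (A : Type u) where
  op : ∀ {n : ℕ}, L.Functions n → (Fin n → A) → A → Prop
  op_unique : ∀ {n : ℕ} (f : L.Functions n) (x : Fin n → A) (a b : A),
    op f x a → op f x b → a = b

variable {L : FirstOrder.Language.{u, u}} {A : Type u} [PartialAlgebra L A]

/-- `EvalsTo v t a`: the term `t` is defined in `A` at the assignment `v`, with value `a`. -/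
def EvalsTo {α : Type v} (v : α → A) : L.Term α → A → Prop
  | .var i, a => v i = a
  | .func f ts, a => ∃ b : Fin _ → A, (∀ i, EvalsTo v (ts i) (b i)) ∧ PartialAlgebra.op f b a

variable (A) in
/-- A partial algebra satisfies an identity if both sides are equal whenever both are defined. -/
def PSatisfies (e : Identity L) : Prop :=
  ∀ (v : ℕ → A) (a b : A), EvalsTo v e.1 a → EvalsTo v e.2 b → a = b

variable (L A) in
/-- A partial subalgebra of `A`: a subset, with domains of definition `dom f` contained in those
of `A`, such that the operations take their values in the subset there. -/
structure PartialSubalgebra where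
  carrier : Set A
  dom : ∀ {n : ℕ}, L.Functions n → Set (Fin n → A)
  mem_of_dom : ∀ {n : ℕ} (f : L.Functions n), ∀ x ∈ dom f, ∀ i, x i ∈ carrier
  op_of_dom : ∀ {n : ℕ} (f : L.Functions n), ∀ x ∈ dom f, ∃ a ∈ carrier, PartialAlgebra.op f x a

end PartialAlgebras

/-! ### Pregamps and gamps -/

/-- A pregamp `(A, δ, S)`: a partial algebra with a distance, valued in a `(∨, 0)`-semilattice,
that is compatible with the operations. -/
structure Pregamp (L : FirstOrder.Language.{u, u}) : Type (u + 1) where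
  carrier : Type u
  [palg : PartialAlgebra L carrier]
  sem : Type u
  [semSup : SemilatticeSup sem]
  [semBot : OrderBot sem]
  dist : carrier → carrier → sem
  dist_eq_bot : ∀ x y, dist x y = ⊥ ↔ x = y
  dist_comm : ∀ x y, dist x y = dist y x
  dist_triangle : ∀ x y z, dist x y ≤ dist x z ⊔ dist z y
  dist_op : ∀ {n : ℕ} (f : L.Functions n) (x y : Fin n → carrier) (a b : carrier),
    PartialAlgebra.op f x a → PartialAlgebra.op f y b →
      dist a b ≤ Finset.univ.sup fun i => dist (x i) (y i)

attribute [instance] Pregamp.palg Pregamp.semSup Pregamp.semBot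

namespace Pregamp

variable {L : FirstOrder.Language.{u, u}}

/-- The equivalence relation `δ(x, y) ∈ I` for an ideal `I`. -/
def idealSetoid (A : Pregamp L) (I : Order.Ideal A.sem) : Setoid A.carrier where
  r x y := A.dist x y ∈ I
  iseqv := by
    refine ⟨fun x => ?_, fun {x y} h => ?_, fun {x y z} h₁ h₂ => ?_⟩
    · rw [(A.dist_eq_bot x x).2 rfl]
      exact I.bot_mem
    · rw [A.dist_comm]
      exact h
    · exact I.lower (A.dist_triangle x z y) (Order.Ideal.sup_mem h₁ h₂)

/-- The universe of the quotient `A/I`. -/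
def QuotCarrier (A : Pregamp L) (I : Order.Ideal A.sem) : Type u :=
  Quotient (A.idealSetoid I)

/-- The canonical projection. -/
def toQuot (A : Pregamp L) (I : Order.Ideal A.sem) (x : A.carrier) : A.QuotCarrier I :=
  Quotient.mk (A.idealSetoid I) x

/-- The partial algebra `A/I`: the domains of definition are the images of those of `A`, and
`f(x/I) = f(x)/I`. -/
instance (A : Pregamp L) (I : Order.Ideal A.sem) : PartialAlgebra L (A.QuotCarrier I) where
  op f z c := ∃ x a, PartialAlgebra.op f x a ∧ (∀ i, A.toQuot I (x i) = z i) ∧ A.toQuot I a = c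
  op_unique := by
    rintro n f z _ _ ⟨x, a, hx, hxz, rfl⟩ ⟨y, b, hy, hyz, rfl⟩
    refine Quotient.sound (s := A.idealSetoid I) ?_
    refine I.lower (A.dist_op f x y a b hx hy) ?_
    refine (Order.Ideal.finsetSup_mem_iff I).2 fun i _ => ?_
    exact Quotient.exact (s := A.idealSetoid I) ((hxz i).trans (hyz i).symm)

/-- A pregamp of the variety `V`: all its quotients satisfy all the identities of `V`. -/
def IsOf (A : Pregamp L) (V : Variety L) : Prop :=
  ∀ I : Order.Ideal A.sem, ∀ e ∈ identitiesOf V, PSatisfies (A.QuotCarrier I) e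

end Pregamp

section Gamps

variable {L : FirstOrder.Language.{u, u}}

/-- A gamp of the variety `V`: a pregamp of `V` with a partial subalgebra `A*`. -/
structure Gamp (V : Variety L) : Type (u + 1) extends Pregamp L where
  isOf : toPregamp.IsOf V
  star : PartialSubalgebra L toPregamp.carrier

variable {V : Variety L}

/-- A morphism of gamps: a pair of a morphism of partial algebras and a morphism of semilattices,
compatible with the distances, such that `f(A*)` is a partial subalgebra of `B*`. -/
@[ext]
structure GampHom (A B : Gamp V) where
  toFun : A.carrier → B.carrier
  semHom : SupBotHom A.sem B.sem
  map_op : ∀ {n : ℕ} (f : L.Functions n) (x : Fin n → A.carrier) (a : A.carrier),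
    PartialAlgebra.op f x a → PartialAlgebra.op f (fun i => toFun (x i)) (toFun a)
  map_dist : ∀ x y, B.dist (toFun x) (toFun y) = semHom (A.dist x y)
  map_star : ∀ x ∈ A.star.carrier, toFun x ∈ B.star.carrier
  map_dom : ∀ {n : ℕ} (f : L.Functions n), ∀ x ∈ A.star.dom f,
    (fun i => toFun (x i)) ∈ B.star.dom f

/-- The category `GAMP(V)`. -/
instance : Category.{u} (Gamp V) where
  Hom A B := GampHom A B
  id A :=
    { toFun := id
      semHom := SupBotHom.id A.sem
      map_op := fun _ _ _ h => h
      map_dist := fun _ _ => rfl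
      map_star := fun _ h => h
      map_dom := fun _ _ h => h }
  comp {A B C} F G :=
    { toFun := fun x => G.toFun (F.toFun x)
      semHom := G.semHom.comp F.semHom
      map_op := fun f x a h => G.map_op f _ _ (F.map_op f x a h)
      map_dist := fun x y => by rw [G.map_dist, F.map_dist]; rfl
      map_star := fun x h => G.map_star _ (F.map_star x h)
      map_dom := fun f x h => G.map_dom f _ (F.map_dom f x h) }

variable (V) in
/-- The forgetful functor from gamps to `(∨, 0)`-semilattices. -/
def gampSem : Gamp V ⥤ SemilatSupCat.{u} where
  obj A := SemilatSupCat.of A.sem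
  map F := F.semHom

/-- A realization of a gamp of `V`: an algebra `A'` in `V` that has `A` as a partial subalgebra,
with an embedding `χ` of semilattices such that `χ(δ(x, y)) = Θ_{A'}(x, y)`. -/
structure Realization (A : Gamp V) where
  alg : Alg V
  incl : A.carrier → alg.carrier
  incl_injective : Function.Injective incl
  incl_op : ∀ {n : ℕ} (f : L.Functions n) (x : Fin n → A.carrier) (a : A.carrier),
    PartialAlgebra.op f x a → FirstOrder.Language.Structure.funMap f (fun i => incl (x i)) = incl a
  χ : SupBotHom A.sem (Conc L alg.carrier)
  χ_injective : Function.Injective χ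
  χ_dist : ∀ x y, χ (A.dist x y) = theta L (incl x) (incl y)

namespace Gamp

variable (A : Gamp V)

/-- There is a realization in which `χ` is an isomorphism. -/
def HasIsomorphicRealization : Prop :=
  ∃ R : Realization A, Function.Bijective R.χ

/-- `A*` is a strong partial subalgebra of `A`. -/
def IsStrong : Prop :=
  ∀ {n : ℕ} (f : L.Functions n) (x : Fin n → A.carrier), (∀ i, x i ∈ A.star.carrier) →
    ∃ a, PartialAlgebra.op f x a

/-- Every element of the semilattice is a finite join of distances between elements of `A*`. -/
def IsDistanceGenerated : Prop :=
  ∀ s : A.sem, ∃ (n : ℕ) (x y : Fin n → A.carrier),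
    (∀ k, x k ∈ A.star.carrier) ∧ (∀ k, y k ∈ A.star.carrier) ∧
      s = Finset.univ.sup fun k => A.dist (x k) (y k)

/-- Inequalities between distances of elements of `A*` have a Mal'cev-type witness in `A`: terms
`t₀, …, tₙ` in the variables `x⃗, y⃗, z⃗` with `x = t₀(x⃗, y⃗, z⃗)`, `y = tₙ(x⃗, y⃗, z⃗)` and
`tₖ(y⃗, x⃗, z⃗) = tₖ₊₁(x⃗, y⃗, z⃗)` for `k < n`, all of these being defined in `A`. -/
def IsCongruenceTractable : Prop :=
  ∀ (m : ℕ) (x y : A.carrier) (xs ys : Fin m → A.carrier),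
    x ∈ A.star.carrier → y ∈ A.star.carrier →
    (∀ k, xs k ∈ A.star.carrier) → (∀ k, ys k ∈ A.star.carrier) →
    A.dist x y ≤ (Finset.univ.sup fun k => A.dist (xs k) (ys k)) →
    ∃ (n l : ℕ) (zs : Fin l → A.carrier) (t : ℕ → L.Term (Fin m ⊕ Fin m ⊕ Fin l)), 0 < n ∧
      EvalsTo (Sum.elim xs (Sum.elim ys zs)) (t 0) x ∧
      EvalsTo (Sum.elim xs (Sum.elim ys zs)) (t n) y ∧
      ∀ k < n, ∃ a, EvalsTo (Sum.elim ys (Sum.elim xs zs)) (t k) a ∧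
        EvalsTo (Sum.elim xs (Sum.elim ys zs)) (t (k + 1)) a

end Gamp

namespace GampHom

variable {A B : Gamp V} (F : GampHom A B)

/-- `f(A)`, with the domains of definition `f(Def_ℓ(A))`, is a partial subalgebra of `B*`. -/
def RangeInStar : Prop :=
  (∀ x, F.toFun x ∈ B.star.carrier) ∧
    ∀ {n : ℕ} (f : L.Functions n) (x : Fin n → A.carrier) (a : A.carrier),
      PartialAlgebra.op f x a → (fun i => F.toFun (x i)) ∈ B.star.dom f

/-- `f(A)` is a strong partial subalgebra of `B*`. -/
def IsStrong : Prop :=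
  F.RangeInStar ∧ ∀ {n : ℕ} (f : L.Functions n) (x : Fin n → A.carrier),
    (fun i => F.toFun (x i)) ∈ B.star.dom f

/-- `f(A)` is a partial subalgebra of `B*`, and if `δ(f(x), f(y)) ≤ ⋁ X` with `X` finite then there
is a path from `f(x)` to `f(y)` in `B*` each of whose steps has length below an element of `X`. -/
def IsCongruenceCuttable : Prop :=
  F.RangeInStar ∧ ∀ (X : Finset B.sem) (x y : A.carrier),
    B.dist (F.toFun x) (F.toFun y) ≤ X.sup id →
    ∃ (n : ℕ) (z : ℕ → B.carrier), z 0 = F.toFun x ∧ z n = F.toFun y ∧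
      (∀ k ≤ n, z k ∈ B.star.carrier) ∧
      ∀ k < n, ∃ s ∈ X, B.dist (z k) (z (k + 1)) ≤ s

end GampHom

/-! ### Partial liftings -/

variable {P : Type w} [Preorder P]

/-- A diagram of gamps of `V` is a partial lifting. -/
structure IsPartialLifting (G : P ⥤ Gamp V) : Prop where
  strong : ∀ p, (G.obj p).IsStrong
  congruenceTractable : ∀ p, (G.obj p).IsCongruenceTractable
  distanceGenerated : ∀ p, (G.obj p).IsDistanceGenerated
  isomorphicRealization : ∀ p, (G.obj p).HasIsomorphicRealization
  map_strong : ∀ (p q : P) (h : p < q), GampHom.IsStrong (G.map (homOfLE h.le))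
  map_cuttable : ∀ (p q : P) (h : p < q), GampHom.IsCongruenceCuttable (G.map (homOfLE h.le))

variable (V) in
/-- The diagram `S` of semilattices has a partial lifting in `V`. -/
def HasPartialLifting (S : P ⥤ SemilatSupCat.{u}) : Prop :=
  ∃ G : P ⥤ Gamp V, IsPartialLifting G ∧ Nonempty (G ⋙ gampSem V ≅ S)

end Gamps

/-- A lower finite tree: every principal lower set is a finite chain. -/
def IsLowerFiniteTree (T : Type w) [PartialOrder T] : Prop :=
  ∀ t : T, (Set.Iic t).Finite ∧ IsChain (· ≤ ·) (Set.Iic t)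

end UA

namespace UA

open FirstOrder.Language.Structure (funMap)

/-! ### Compact congruences and the distance `theta`. -/

section Basics

variable {L : FirstOrder.Language.{u, u}} {A : Type u} [L.Structure A]

/-! From 1 to 2, the whole diagram is packed into one countable algebra. Consider families with an
entry in `A t` for every labelling `g : T → ℕ` and every point `t`. The entry at `t` may depend only
on the labels below `t`, and the entries must commute with the transition map from `s` to `t` as
soon as the labels in the interval `(s, t]` pass a bound that depends on the family. The tree
property and local finiteness give a countable algebra `C` of such families that projects onto every
`A t` under every labelling (`exists_condensate`). By 1, its compact congruences are those of some
`B` in `W`. Each projection of `C` then turns `theta` on `B` into a distance with values in the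
compact congruences of `A t`, and this distance represents the compact congruences of the quotient
of `B` by its kernel (`isPreConDist_of_surjective`, `IsPreConDist.isConDist`).

A fixed labelling need not make these distances compatible on all of `B`, but a gamp involves only a
finite part of `B`. A recursion along `T` selects at each point finite sets that contain every
witness required there (`exists_isStage`). The labels of later points are taken beyond the bounds
that these finite sets impose (`Condensate.exists_tower`). The images of the sets in the quotients
of `B` form the partial lifting (`Tower.isPartialLifting`).

The step from 2 to 3 holds because the natural numbers form a countable lower finite tree.

From 3 to 1, let `A` in `V` have countably many compact congruences. Local finiteness gives an
increasing sequence of finite subalgebras whose semilattices of compact congruences have that of `A`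
as their colimit (`exists_chain`). A partial lifting of this sequence has a colimit in `W`: strong
morphisms make all operations total, and congruence-tractability makes the limit distance represent
the compact congruences (`ColimitData.tract`, `ColimitData.isConDist`). -/

theorem AlgCon.subset_gen {r : A → A → Prop} {x y : A} (h : r x y) :
    (AlgCon.gen r : AlgCon L A).r x y :=
  AlgCon.gen_le.1 le_rfl x y h

theorem theta_le {x y : A} {θ : Conc L A} : theta L x y ≤ θ ↔ θ.1.r x y :=
  AlgCon.principal_le

theorem Conc.coe_sup (θ ψ : Conc L A) : (θ ⊔ ψ).1 = θ.1 ⊔ ψ.1 := rfl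

theorem Conc.coe_bot : (⊥ : Conc L A).1 = ⊥ := rfl

theorem Conc.coe_le {θ ψ : Conc L A} : θ ≤ ψ ↔ θ.1 ≤ ψ.1 := Iff.rfl

/-- The congruences above a finite join of principal congruences. -/
theorem sup_theta_le_iff {F : Finset (A × A)} {ψ : AlgCon L A} :
    (F.sup fun p => theta L p.1 p.2).1 ≤ ψ ↔ ∀ p ∈ F, ψ.r p.1 p.2 := by
  classical
  induction F using Finset.induction with
  | empty => simp [Conc.coe_bot]
  | insert a s _ ih =>
    rw [Finset.sup_insert, Conc.coe_sup, sup_le_iff, ih, Finset.forall_mem_insert]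
    exact and_congr AlgCon.principal_le Iff.rfl

/-- Compact congruences are finitely generated. -/
theorem Conc.exists_finset (θ : Conc L A) :
    ∃ F : Finset (A × A), θ = F.sup fun p => theta L p.1 p.2 := by
  classical
  obtain ⟨t, ht, hle⟩ := (CompleteLattice.isCompactElement_iff_exists_le_sSup_of_le_sSup _ _).1 θ.2
    ((fun p : A × A => AlgCon.principal p.1 p.2) '' {p | θ.1.r p.1 p.2}) (by
      intro x y h
      exact AlgCon.principal_le.1 (le_sSup ⟨(x, y), h, rfl⟩))
  obtain ⟨F, hF, rfl⟩ := Finset.subset_set_image_iff.1 ht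
  refine ⟨F, le_antisymm (hle.trans ?_) (Conc.coe_le.2 (sup_theta_le_iff.2 fun p hp => hF hp))⟩
  rw [Finset.sup_image, Function.id_comp]
  exact Finset.sup_le fun p hp => AlgCon.principal_le.2 (sup_theta_le_iff.1 le_rfl p hp)

theorem AlgCon.bot_r {x y : A} : (⊥ : AlgCon L A).r x y ↔ x = y := by
  constructor
  · intro h
    let E : AlgCon L A :=
      { r := fun a b => a = b
        iseqv := eq_equivalence
        map_rel := fun f x y h => by rw [funext h] }
    exact (bot_le : ⊥ ≤ E) x y h
  · rintro rfl
    exact (⊥ : AlgCon L A).iseqv.refl x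

theorem theta_eq_bot {x y : A} : theta L x y = ⊥ ↔ x = y := by
  rw [← le_bot_iff, theta_le, Conc.coe_bot, AlgCon.bot_r]

theorem theta_r (x y : A) : (theta L x y).1.r x y := theta_le.1 le_rfl

theorem theta_comm (x y : A) : theta L x y = theta L y x :=
  le_antisymm (theta_le.2 ((theta L y x).1.iseqv.symm (theta_r y x)))
    (theta_le.2 ((theta L x y).1.iseqv.symm (theta_r x y)))

theorem theta_triangle (x y z : A) : theta L x y ≤ theta L x z ⊔ theta L z y :=
  theta_le.2 ((theta L x z ⊔ theta L z y).1.iseqv.trans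
    (theta_le.1 (le_sup_left : theta L x z ≤ _)) (theta_le.1 (le_sup_right : theta L z y ≤ _)))

theorem theta_op {n : ℕ} (f : L.Functions n) (x y : Fin n → A) :
    theta L (funMap f x) (funMap f y) ≤ Finset.univ.sup fun i => theta L (x i) (y i) :=
  theta_le.2 (AlgCon.map_rel _ f x y fun i => theta_le.1
    (Finset.le_sup (f := fun i => theta L (x i) (y i)) (Finset.mem_univ i)))

instance [Countable A] : Countable (Conc L A) :=
  Function.Surjective.countable (f := fun F : Finset (A × A) => F.sup fun p => theta L p.1 p.2)
    fun θ => (Conc.exists_finset θ).imp fun _ h => h.symm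

instance [Finite A] : Finite (Conc L A) :=
  Finite.of_surjective (fun F : Finset (A × A) => F.sup fun p => theta L p.1 p.2)
    fun θ => (Conc.exists_finset θ).imp fun _ h => h.symm

variable {B : Type u} [L.Structure B]

theorem Conc.map_theta (f : A →[L] B) (x y : A) :
    Conc.map f (theta L x y) = theta L (f x) (f y) := by
  apply Subtype.ext
  refine eq_of_forall_ge_iff fun ψ => ?_
  refine (AlgCon.gc_map_comap f _ _).trans ?_
  exact AlgCon.principal_le.trans (AlgCon.principal_le (x := f x) (y := f y)).symm

theorem Conc.map_sup_theta (f : A →[L] B) (F : Finset (A × A)) :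
    Conc.map f (F.sup fun p => theta L p.1 p.2) =
      F.sup fun p => theta L (f p.1) (f p.2) := by
  rw [map_finset_sup]
  exact Finset.sup_congr rfl fun p _ => Conc.map_theta f p.1 p.2

/-- Every element of `Con_c B` comes from `Con_c A` if the homomorphism `A → B` is onto. -/
theorem Conc.map_surjective (f : A →[L] B) (hf : Function.Surjective f) :
    Function.Surjective (Conc.map f) := by
  classical
  intro θ
  obtain ⟨F, rfl⟩ := θ.exists_finset
  choose g hg using hf
  refine ⟨(F.image fun p => (g p.1, g p.2)).sup fun p => theta L p.1 p.2, ?_⟩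
  rw [Conc.map_sup_theta, Finset.sup_image]
  refine Finset.sup_congr rfl fun p _ => ?_
  simp [hg]

/-- For a surjective homomorphism, inequalities between images of compact congruences hold
modulo a compact congruence that the homomorphism kills. -/
theorem Conc.exists_le_sup_of_map_le (f : A →[L] B) (hf : Function.Surjective f)
    {α β : Conc L A} (h : Conc.map f α ≤ Conc.map f β) :
    ∃ γ : Conc L A, Conc.map f γ = ⊥ ∧ α ≤ β ⊔ γ := by
  classical
  let K : AlgCon L A := AlgCon.comap f ⊥
  -- Since `f` is onto, the image of a congruence that contains its kernel is again a congruence, so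
  -- `f α ≤ f β` amounts to `α ≤ β ⊔ K`. Compactness of `α` then replaces `K` by a finitely
  -- generated part.
  let D : AlgCon L B :=
    { r := fun x y => ∃ a a', f a = x ∧ f a' = y ∧ (β.1 ⊔ K).r a a'
      iseqv := by
        refine ⟨fun x => ?_, ?_, ?_⟩
        · obtain ⟨a, rfl⟩ := hf x
          exact ⟨a, a, rfl, rfl, (β.1 ⊔ K).iseqv.refl a⟩
        · rintro _ _ ⟨a, a', rfl, rfl, h⟩
          exact ⟨a', a, rfl, rfl, (β.1 ⊔ K).iseqv.symm h⟩
        · rintro _ _ _ ⟨a, a', rfl, rfl, h⟩ ⟨b, b', hb, rfl, h'⟩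
          refine ⟨a, b', rfl, rfl, (β.1 ⊔ K).iseqv.trans h ((β.1 ⊔ K).iseqv.trans ?_ h')⟩
          exact (le_sup_right : K ≤ β.1 ⊔ K) a' b (AlgCon.bot_r.2 hb.symm)
      map_rel := by
        intro n g x y h
        choose a a' ha ha' hr using h
        refine ⟨funMap g a, funMap g a', ?_, ?_, (β.1 ⊔ K).map_rel g a a' hr⟩
        · rw [f.map_fun]; congr 1; exact funext ha
        · rw [f.map_fun]; congr 1; exact funext ha' }
  have h1 : (Conc.map f β).1 ≤ D :=
    (AlgCon.gc_map_comap f _ _).2 fun x y hxy =>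
      ⟨x, y, rfl, rfl, (le_sup_left : β.1 ≤ β.1 ⊔ K) x y hxy⟩
  have h2 : α.1 ≤ β.1 ⊔ K := by
    intro x y hxy
    obtain ⟨a, a', ha, ha', hr⟩ := (AlgCon.gc_map_comap f _ _).1 (le_trans h h1) x y hxy
    have hK : ∀ {p q : A}, f p = f q → (β.1 ⊔ K).r p q := fun {p q} e =>
      (le_sup_right : K ≤ β.1 ⊔ K) p q (AlgCon.bot_r.2 e)
    exact (β.1 ⊔ K).iseqv.trans (hK ha.symm) ((β.1 ⊔ K).iseqv.trans hr (hK ha'))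
  obtain ⟨t, ht, hle⟩ := (CompleteLattice.isCompactElement_iff_exists_le_sSup_of_le_sSup _ _).1 α.2
    (insert β.1 ((fun p : A × A => AlgCon.principal p.1 p.2) '' {p | f p.1 = f p.2})) (by
      rw [sSup_insert]
      refine h2.trans (sup_le_sup_left ?_ _)
      intro x y h
      exact AlgCon.principal_le.1 (le_sSup ⟨(x, y), AlgCon.bot_r.1 h, rfl⟩))
  obtain ⟨F, hF, hFt⟩ := Finset.subset_set_image_iff.1
    (show ↑(t.erase β.1) ⊆ (fun p : A × A => AlgCon.principal p.1 p.2) '' {p | f p.1 = f p.2} from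
      fun ψ hψ => (ht (Finset.mem_of_mem_erase hψ)).resolve_left (Finset.ne_of_mem_erase hψ))
  refine ⟨F.sup fun p => theta L p.1 p.2, ?_, ?_⟩
  · rw [Conc.map_sup_theta, ← le_bot_iff, Finset.sup_le_iff]
    exact fun p hp => (theta_eq_bot.2 (hF hp)).le
  · refine hle.trans (Finset.sup_le fun ψ h => ?_)
    by_cases e : ψ = β.1
    · rw [e]; exact (le_sup_left : β ≤ _)
    · have h' := Finset.mem_erase.2 ⟨e, h⟩
      rw [← hFt] at h'
      obtain ⟨p, hp, rfl⟩ := Finset.mem_image.1 h'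
      refine le_trans (AlgCon.principal_le.2 ?_) (Conc.coe_le.1 (le_sup_right : _ ≤ β ⊔ _))
      exact sup_theta_le_iff.1 le_rfl p hp

end Basics

/-! ### Distances that represent the compact congruences -/

section ConDist

variable {L : FirstOrder.Language.{u, u}} {B : Type u} [L.Structure B]
  {S : Type u} [SemilatticeSup S] [OrderBot S]

variable (L) in
/-- A distance on an algebra with values in a semilattice that is isomorphic to
`Θ_B : B × B → Con_c B`. -/
structure IsConDist (d : B → B → S) : Prop where
  eq_bot : ∀ x y, d x y = ⊥ ↔ x = y
  comm : ∀ x y, d x y = d y x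
  triangle : ∀ x y z, d x y ≤ d x z ⊔ d z y
  op : ∀ {n : ℕ} (f : L.Functions n) (x y : Fin n → B),
    d (funMap f x) (funMap f y) ≤ Finset.univ.sup fun i => d (x i) (y i)
  tract : ∀ (F : Finset (B × B)) (x y : B), d x y ≤ (F.sup fun p => d p.1 p.2) →
    ∀ ψ : AlgCon L B, (∀ p ∈ F, ψ.r p.1 p.2) → ψ.r x y
  gen : ∀ s : S, ∃ F : Finset (B × B), s = F.sup fun p => d p.1 p.2

namespace IsConDist

variable {d : B → B → S} (hd : IsConDist L d)

include hd

/-- The congruence `d(x, y) ∈ I` for an ideal `I`. -/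
def idealCon (I : Order.Ideal S) : AlgCon L B where
  r x y := d x y ∈ I
  iseqv := by
    refine ⟨fun x => ?_, fun {x y} h => ?_, fun {x y z} h h' => ?_⟩
    · rw [(hd.eq_bot x x).2 rfl]; exact I.bot_mem
    · rw [hd.comm]; exact h
    · exact I.lower (hd.triangle x z y) (Order.Ideal.sup_mem h h')
  map_rel f x y h := I.lower (hd.op f x y) ((Order.Ideal.finsetSup_mem_iff I).2 fun i _ => h i)

/-- The field `tract` is exactly the nontrivial inclusion: whatever lies within the join of the
given distances is already forced by the pairs. -/
theorem idealCon_principal (F : Finset (B × B)) :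
    hd.idealCon (Order.Ideal.principal (F.sup fun p => d p.1 p.2)) =
      (F.sup fun p => theta L p.1 p.2).1 := by
  refine le_antisymm ?_ ?_
  · intro x y h
    exact hd.tract F x y h _ (sup_theta_le_iff.1 le_rfl)
  · exact sup_theta_le_iff.2 fun p hp => Finset.le_sup (f := fun p : B × B => d p.1 p.2) hp

/-- The isomorphism from the values of the distance to the compact congruences. -/
theorem exists_iso : ∃ χ : SupBotHom S (Conc L B), Function.Bijective χ ∧
    ∀ x y, χ (d x y) = theta L x y := by
  classical
  have hc : ∀ s : S, IsCompactElement (hd.idealCon (Order.Ideal.principal s)) := by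
    intro s
    obtain ⟨F, rfl⟩ := hd.gen s
    rw [idealCon_principal]
    exact Subtype.property _
  let χ : S → Conc L B := fun s => ⟨_, hc s⟩
  have hχ : ∀ F : Finset (B × B), χ (F.sup fun p => d p.1 p.2) = F.sup fun p => theta L p.1 p.2 :=
    fun F => Subtype.ext (hd.idealCon_principal F)
  refine ⟨⟨⟨χ, ?_⟩, ?_⟩, ⟨?_, ?_⟩, ?_⟩
  · intro s t
    obtain ⟨F, rfl⟩ := hd.gen s
    obtain ⟨G, rfl⟩ := hd.gen t
    rw [← Finset.sup_union, hχ, hχ, hχ, Finset.sup_union]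
  · exact hχ ∅
  -- A pair lies in `χ t` exactly when its distance is at most `t`, so `t` can be tested against the
  -- distances that generate `s`.
  · have key : ∀ s t, χ s = χ t → s ≤ t := by
      intro s t h
      obtain ⟨F, rfl⟩ := hd.gen s
      refine Finset.sup_le fun p hp => ?_
      have : (χ (F.sup fun p => d p.1 p.2)).1.r p.1 p.2 :=
        Finset.le_sup (f := fun p : B × B => d p.1 p.2) hp
      rw [h] at this
      exact this
    exact fun s t h => le_antisymm (key s t h) (key t s h.symm)
  · intro θ
    obtain ⟨F, rfl⟩ := θ.exists_finset
    exact ⟨_, hχ F⟩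
  · intro x y
    exact (congrArg χ (Finset.sup_singleton).symm).trans
      ((hχ {(x, y)}).trans Finset.sup_singleton)

end IsConDist

end ConDist

/-! ### Mal'cev chains -/

section Malcev

variable {L : FirstOrder.Language.{u, u}} {A : Type u} [L.Structure A]

/-- One step of a Mal'cev chain whose computation stays in the set `D`. -/
inductive Step (L : FirstOrder.Language.{u, u}) {A : Type u} [L.Structure A] (D : Set A)
    (E : A → A → Prop) : A → A → Prop
  | base {u v : A} : E u v → Step L D E u v
  | base_symm {u v : A} : E u v → Step L D E v u
  | refl (u : A) : u ∈ D → Step L D E u u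
  | op {n : ℕ} (f : L.Functions n) (u v : Fin n → A) : (∀ i, Step L D E (u i) (v i)) →
      funMap f u ∈ D → funMap f v ∈ D → Step L D E (funMap f u) (funMap f v)

theorem Step.mono {D D' : Set A} (hD : D ⊆ D') {E E' : A → A → Prop} (hE : ∀ x y, E x y → E' x y)
    {x y : A} (h : Step L D E x y) : Step L D' E' x y := by
  induction h with
  | base h => exact .base (hE _ _ h)
  | base_symm h => exact .base_symm (hE _ _ h)
  | refl u h => exact .refl u (hD h)
  | op f u v _ h h' ih => exact .op f u v ih (hD h) (hD h')

theorem Step.symm {D : Set A} {E : A → A → Prop} {x y : A} (h : Step L D E x y) :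
    Step L D E y x := by
  induction h with
  | base h => exact .base_symm h
  | base_symm h => exact .base h
  | refl u h => exact .refl u h
  | op f u v _ h h' ih => exact .op f v u ih h' h

/-- Operations have finite arity, so the computation behind a step meets only finitely many
elements. -/
theorem Step.exists_finite {E : A → A → Prop} {x y : A} (h : Step L Set.univ E x y) :
    ∃ D : Set A, D.Finite ∧ Step L D E x y := by
  induction h with
  | base h => exact ⟨∅, Set.finite_empty, .base h⟩
  | base_symm h => exact ⟨∅, Set.finite_empty, .base_symm h⟩
  | refl u h => exact ⟨{u}, Set.finite_singleton u, .refl u rfl⟩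
  | op f u v _ h h' ih =>
    choose D hD hs using ih
    refine ⟨(⋃ i, D i) ∪ {funMap f u, funMap f v},
      (Set.finite_iUnion hD).union (Set.toFinite _), .op f u v (fun i => ?_) (by simp) (by simp)⟩
    exact (hs i).mono ((Set.subset_iUnion D i).trans Set.subset_union_left) fun _ _ h => h

/-- A relation that is compatible with changing single arguments is compatible. -/
theorem compatible_of_single {R : A → A → Prop} (hR : Equivalence R) {n : ℕ} (f : L.Functions n)
    (h : ∀ (x : Fin n → A) (i : Fin n) (b : A), R (x i) b →
      R (funMap f x) (funMap f (Function.update x i b))) (x y : Fin n → A)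
    (hxy : ∀ i, R (x i) (y i)) : R (funMap f x) (funMap f y) := by
  classical
  have key : ∀ s : Finset (Fin n), R (funMap f x) (funMap f (s.piecewise y x)) := by
    intro s
    induction s using Finset.induction with
    | empty => simpa using hR.refl _
    | insert a s ha ih =>
      rw [Finset.piecewise_insert]
      refine hR.trans ih (h _ _ _ ?_)
      rw [Finset.piecewise_eq_of_notMem _ _ _ ha]
      exact hxy a
  simpa using key Finset.univ

/-- The congruence of all pairs that are connected by Mal'cev chains. -/
def chainCon (L : FirstOrder.Language.{u, u}) {A : Type u} [L.Structure A]
    (E : A → A → Prop) : AlgCon L A where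
  r := Relation.ReflTransGen (Step L Set.univ E)
  iseqv := ⟨fun _ => .refl, fun h => by
    have : Std.Symm (Step L Set.univ E) := ⟨fun _ _ => Step.symm⟩
    exact Std.Symm.symm _ _ h, .trans⟩
  map_rel := by
    classical
    intro n f x y h
    have hs : Std.Symm (Step L Set.univ E) := ⟨fun _ _ => Step.symm⟩
    refine compatible_of_single (R := Relation.ReflTransGen (Step L Set.univ E))
      ⟨fun _ => .refl, fun h => Std.Symm.symm _ _ h, .trans⟩ f ?_ x y h
    intro x i b hb
    -- A chain in one argument is carried through the operation step by step, the other arguments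
    -- being held fixed by `Step.refl`.
    have : Relation.ReflTransGen (Step L Set.univ E) (funMap f (Function.update x i (x i)))
        (funMap f (Function.update x i b)) := by
      refine hb.lift (fun c => funMap f (Function.update x i c)) ?_
      intro c c' hc
      refine .op f _ _ (fun j => ?_) trivial trivial
      by_cases hj : j = i
      · subst hj; simpa using hc
      · simpa [Function.update_of_ne hj] using Step.refl (x j) (Set.mem_univ _)
    simpa using this

theorem gen_le_chainCon (E : A → A → Prop) : AlgCon.gen E ≤ chainCon L E :=
  AlgCon.gen_le.2 fun _ _ h => .single (.base h)

/-- This finiteness is what allows the witnesses of congruence-tractability to be stored in a finite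
partial algebra. -/
theorem exists_finite_chain {E : A → A → Prop} {x y : A}
    (h : (AlgCon.gen E : AlgCon L A).r x y) :
    ∃ D : Set A, D.Finite ∧ Relation.ReflTransGen (Step L D E) x y := by
  have h' : Relation.ReflTransGen (Step L Set.univ E) x y := gen_le_chainCon E x y h
  clear h
  induction h' with
  | refl => exact ⟨∅, Set.finite_empty, .refl⟩
  | tail _ hs ih =>
    obtain ⟨D, hD, hc⟩ := ih
    obtain ⟨D', hD', hs'⟩ := hs.exists_finite
    refine ⟨D ∪ D', hD.union hD', .tail (Relation.ReflTransGen.mono ?_ _ _ hc) ?_⟩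
    · exact fun _ _ h => h.mono Set.subset_union_left fun _ _ h => h
    · exact hs'.mono Set.subset_union_right fun _ _ h => h

end Malcev

/-! ### Quotient algebras -/

section Quotients

variable {L : FirstOrder.Language.{u, u}} {A : Type u} [L.Structure A]

/-- The quotient of an algebra by a congruence. -/
def AlgCon.Quot (θ : AlgCon L A) : Type u := Quotient θ.toSetoid

/-- The canonical projection, as a map. -/
def AlgCon.proj (θ : AlgCon L A) (x : A) : θ.Quot := Quotient.mk θ.toSetoid x

theorem AlgCon.proj_eq {θ : AlgCon L A} {x y : A} : θ.proj x = θ.proj y ↔ θ.r x y :=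
  ⟨fun h => Quotient.exact (s := θ.toSetoid) h, fun h => Quotient.sound (s := θ.toSetoid) h⟩

theorem AlgCon.proj_surjective (θ : AlgCon L A) : Function.Surjective θ.proj :=
  Quotient.exists_rep (s := θ.toSetoid)

noncomputable instance (θ : AlgCon L A) : L.Structure θ.Quot where
  funMap f x := θ.proj (funMap f fun i => (θ.proj_surjective (x i)).choose)
  RelMap _ _ := False

theorem AlgCon.funMap_proj (θ : AlgCon L A) {n : ℕ} (f : L.Functions n) (x : Fin n → A) :
    funMap f (fun i => θ.proj (x i)) = θ.proj (funMap f x) :=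
  AlgCon.proj_eq.2 (θ.map_rel f _ _ fun i =>
    AlgCon.proj_eq.1 (θ.proj_surjective (θ.proj (x i))).choose_spec)

/-- The canonical projection, as a homomorphism. -/
def AlgCon.projHom [L.IsAlgebraic] (θ : AlgCon L A) : A →[L] θ.Quot where
  toFun := θ.proj
  map_fun' f x := (θ.funMap_proj f x).symm
  map_rel' r := isEmptyElim r

theorem Satisfies.of_surjective {B : Type u} [L.Structure B] {e : Identity L} (h : Satisfies A e)
    (f : A →[L] B) (hf : Function.Surjective f) : Satisfies B e := by
  intro v
  choose g hg using hf
  have hv : v = f ∘ fun n => g (v n) := funext fun n => (hg (v n)).symm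
  rw [hv, FirstOrder.Language.HomClass.realize_term, FirstOrder.Language.HomClass.realize_term,
    h]

theorem Satisfies.of_injective {B : Type u} [L.Structure B] {e : Identity L} (h : Satisfies B e)
    (f : A →[L] B) (hf : Function.Injective f) : Satisfies A e := by
  intro v
  apply hf
  rw [← FirstOrder.Language.HomClass.realize_term, ← FirstOrder.Language.HomClass.realize_term, h]

/-- The quotient of a member of a variety. -/
noncomputable def Alg.quot [L.IsAlgebraic] {V : Variety L} (A : Alg V)
    (θ : AlgCon L A.carrier) : Alg V where
  carrier := θ.Quot
  nonempty := A.nonempty.map θ.proj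
  satisfies e he := (A.satisfies e he).of_surjective θ.projHom θ.proj_surjective

end Quotients

/-! ### Distances modulo their kernels -/

section PreConDist

variable {L : FirstOrder.Language.{u, u}} {B : Type u} [L.Structure B]
  {S : Type u} [SemilatticeSup S] [OrderBot S]

variable (L) in
/-- A distance on an algebra that induces on the quotient by its kernel a distance that represents
the compact congruences. -/
structure IsPreConDist (d : B → B → S) : Prop where
  refl : ∀ x, d x x = ⊥
  comm : ∀ x y, d x y = d y x
  triangle : ∀ x y z, d x y ≤ d x z ⊔ d z y
  op : ∀ {n : ℕ} (f : L.Functions n) (x y : Fin n → B),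
    d (funMap f x) (funMap f y) ≤ Finset.univ.sup fun i => d (x i) (y i)
  tract : ∀ (F : Finset (B × B)) (x y : B), d x y ≤ (F.sup fun p => d p.1 p.2) →
    ∀ ψ : AlgCon L B, (∀ p ∈ F, ψ.r p.1 p.2) → (∀ a b, d a b = ⊥ → ψ.r a b) → ψ.r x y
  gen : ∀ s : S, ∃ F : Finset (B × B), s = F.sup fun p => d p.1 p.2

namespace IsPreConDist

variable {d : B → B → S} (hd : IsPreConDist L d)

include hd

/-- The congruence `d(x, y) = 0`. -/
def ker : AlgCon L B where
  r x y := d x y = ⊥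
  iseqv := by
    refine ⟨hd.refl, fun {x y} h => (hd.comm y x).trans h, fun {x y z} h h' => ?_⟩
    have := hd.triangle x z y
    rwa [h, h', sup_bot_eq, le_bot_iff] at this
  map_rel f x y h := by
    rw [← le_bot_iff]
    exact (hd.op f x y).trans (Finset.sup_le fun i _ => (h i).le)

theorem le_of_ker {x x' y y' : B} (hx : hd.ker.r x x') (hy : hd.ker.r y y') :
    d x y ≤ d x' y' := by
  refine (hd.triangle x y x').trans ?_
  rw [show d x x' = ⊥ from hx, bot_sup_eq]
  refine (hd.triangle x' y y').trans ?_
  rw [hd.comm y', show d y y' = ⊥ from hy, sup_bot_eq]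

/-- The distance on the quotient. -/
def quotDist (x y : hd.ker.Quot) : S :=
  Quotient.liftOn₂ (s₁ := hd.ker.toSetoid) (s₂ := hd.ker.toSetoid) x y d fun _ _ _ _ h h' =>
    le_antisymm (hd.le_of_ker h h') (hd.le_of_ker (hd.ker.iseqv.symm h) (hd.ker.iseqv.symm h'))

@[simp]
theorem quotDist_proj (x y : B) : hd.quotDist (hd.ker.proj x) (hd.ker.proj y) = d x y := rfl

/-- Congruences of the quotient pull back to congruences of `B` that contain the kernel, which are
the ones that `IsPreConDist.tract` speaks about. -/
theorem isConDist [L.IsAlgebraic] : IsConDist L hd.quotDist where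
  eq_bot x y := by
    obtain ⟨x, rfl⟩ := hd.ker.proj_surjective x
    obtain ⟨y, rfl⟩ := hd.ker.proj_surjective y
    exact (AlgCon.proj_eq (θ := hd.ker)).symm
  comm x y := by
    obtain ⟨x, rfl⟩ := hd.ker.proj_surjective x
    obtain ⟨y, rfl⟩ := hd.ker.proj_surjective y
    exact hd.comm x y
  triangle x y z := by
    obtain ⟨x, rfl⟩ := hd.ker.proj_surjective x
    obtain ⟨y, rfl⟩ := hd.ker.proj_surjective y
    obtain ⟨z, rfl⟩ := hd.ker.proj_surjective z
    exact hd.triangle x y z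
  op f x y := by
    obtain ⟨x, rfl⟩ := hd.ker.proj_surjective.comp_left x
    obtain ⟨y, rfl⟩ := hd.ker.proj_surjective.comp_left y
    have := hd.op f x y
    rw [← quotDist_proj hd, ← AlgCon.funMap_proj, ← AlgCon.funMap_proj] at this
    exact this
  tract F x y h ψ hψ := by
    classical
    choose g hg using hd.ker.proj_surjective
    obtain ⟨x, rfl⟩ := hd.ker.proj_surjective x
    obtain ⟨y, rfl⟩ := hd.ker.proj_surjective y
    refine hd.tract (F.image fun p => (g p.1, g p.2)) x y ?_ (AlgCon.comap hd.ker.projHom ψ) ?_ ?_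
    · rw [Finset.sup_image]
      refine le_trans h (Finset.sup_mono_fun fun p _ => ?_)
      conv_lhs => rw [← hg p.1, ← hg p.2]
      exact le_rfl
    · intro p hp
      obtain ⟨q, hq, rfl⟩ := Finset.mem_image.1 hp
      change ψ.r (hd.ker.proj (g q.1)) (hd.ker.proj (g q.2))
      rw [hg, hg]
      exact hψ q hq
    · intro a b hab
      change ψ.r (hd.ker.proj a) (hd.ker.proj b)
      rw [AlgCon.proj_eq.2 hab]
  gen s := by
    classical
    obtain ⟨F, rfl⟩ := hd.gen s
    refine ⟨F.image fun p => (hd.ker.proj p.1, hd.ker.proj p.2), ?_⟩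
    rw [Finset.sup_image]
    rfl

end IsPreConDist

/-- A representation of `Con_c B` as `Con_c C` and a surjective homomorphism from `C` to `K` yield a
distance on `B` with values in `Con_c K`. -/
theorem isPreConDist_of_surjective {L' : FirstOrder.Language.{u, u}} {C K : Type u}
    [L'.Structure C] [L'.Structure K] (χ : SupBotHom (Conc L B) (Conc L' C))
    (hχ : Function.Bijective χ) (π : C →[L'] K) (hπ : Function.Surjective π) :
    IsPreConDist L fun b b' : B => Conc.map π (χ (theta L b b')) where
  refl x := by rw [theta_eq_bot.2 rfl, map_bot, map_bot]
  comm x y := by rw [theta_comm]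
  triangle x y z := by
    rw [← map_sup, ← map_sup]
    exact OrderHomClass.mono _ (OrderHomClass.mono _ (theta_triangle x y z))
  op f x y := by
    have := OrderHomClass.mono (Conc.map π) (OrderHomClass.mono χ (theta_op f x y))
    rwa [map_finset_sup, map_finset_sup] at this
  tract F x y h ψ hψ hker := by
    have h' : Conc.map π (χ (theta L x y)) ≤
        Conc.map π (χ (F.sup fun p => theta L p.1 p.2)) := by
      rw [map_finset_sup, map_finset_sup]
      exact h
    -- The error term `γ` is killed by `π`, so it comes from a compact congruence of `B` inside the
    -- kernel of the distance; by hypothesis `ψ` contains that kernel.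
    obtain ⟨γ, hγ, hle⟩ := Conc.exists_le_sup_of_map_le π hπ h'
    obtain ⟨γ, rfl⟩ := hχ.2 γ
    rw [← map_sup] at hle
    have hle' : theta L x y ≤ (F.sup fun p => theta L p.1 p.2) ⊔ γ := by
      rw [← sup_eq_right] at hle ⊢
      rw [← map_sup] at hle
      exact hχ.1 hle
    have h1 : (F.sup fun p => theta L p.1 p.2).1 ≤ ψ := sup_theta_le_iff.2 hψ
    have h2 : γ.1 ≤ ψ := by
      intro a b hab
      refine hker a b ?_
      rw [← le_bot_iff, ← hγ]
      exact OrderHomClass.mono _ (OrderHomClass.mono _ (theta_le.2 hab))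
    exact sup_le h1 h2 x y (theta_le.1 hle')
  gen s := by
    obtain ⟨α, rfl⟩ := Conc.map_surjective π hπ s
    obtain ⟨β, rfl⟩ := hχ.2 α
    obtain ⟨F, rfl⟩ := β.exists_finset
    exact ⟨F, by rw [map_finset_sup, map_finset_sup]; rfl⟩

end PreConDist

/-! ### Terms in partial algebras -/

section Partial

variable {L : FirstOrder.Language.{u, u}} {A : Type u} [PartialAlgebra L A]

theorem EvalsTo.relabel {α β : Type*} {v : β → A} {g : α → β} {t : L.Term α} {a : A} :
    EvalsTo v (t.relabel g) a ↔ EvalsTo (v ∘ g) t a := by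
  induction t generalizing a with
  | var i => rfl
  | func f ts ih =>
    change (∃ b : Fin _ → A, (∀ i, EvalsTo v ((ts i).relabel g) (b i)) ∧ _) ↔
      ∃ b : Fin _ → A, (∀ i, EvalsTo (v ∘ g) (ts i) (b i)) ∧ _
    simp only [ih]

theorem EvalsTo.map {B : Type u} [PartialAlgebra L B] {h : A → B}
    (hop : ∀ {n : ℕ} (f : L.Functions n) (x : Fin n → A) (a : A), PartialAlgebra.op f x a →
      PartialAlgebra.op f (fun i => h (x i)) (h a)) {α : Type*} {v : α → A} {t : L.Term α} {a : A}
    (ht : EvalsTo v t a) : EvalsTo (fun i => h (v i)) t (h a) := by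
  induction t generalizing a with
  | var i => exact congrArg h ht
  | func f ts ih =>
    obtain ⟨b, hb, ho⟩ := ht
    exact ⟨fun i => h (b i), fun i => ih i (hb i), hop f b a ho⟩

theorem EvalsTo.realize {B : Type u} [L.Structure B] {h : A → B}
    (hop : ∀ {n : ℕ} (f : L.Functions n) (x : Fin n → A) (a : A), PartialAlgebra.op f x a →
      funMap f (fun i => h (x i)) = h a) {α : Type*} {v : α → A} {t : L.Term α} {a : A}
    (ht : EvalsTo v t a) : t.realize (fun i => h (v i)) = h a := by
  induction t generalizing a with
  | var i => exact congrArg h ht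
  | func f ts ih =>
    obtain ⟨b, hb, ho⟩ := ht
    rw [FirstOrder.Language.Term.realize, ← hop f b a ho]
    exact congrArg _ (funext fun i => ih i (hb i))

end Partial

/-! ### Gamps that are subsets of algebras -/

section Induced

variable {L : FirstOrder.Language.{u, u}} [L.IsAlgebraic] {W : Variety L}
  {S : Type u} [SemilatticeSup S] [OrderBot S]

/-- The partial algebra on a subset of an algebra, an operation being defined when its value is in
the subset. -/
instance inducedPartialAlgebra {Q : Type u} [L.Structure Q] (D : Set Q) : PartialAlgebra L D where
  op f x a := funMap f (fun i => (x i : Q)) = a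
  op_unique _ _ _ _ h h' := Subtype.ext (h.symm.trans h')

/-- The pregamp on a subset `D` of an algebra with a distance. -/
def inducedPregamp {Q : Type u} [L.Structure Q] (d : Q → Q → S) (hd : IsConDist L d)
    (D : Set Q) : Pregamp L where
  carrier := D
  sem := S
  dist x y := d x y
  dist_eq_bot x y := (hd.eq_bot _ _).trans Subtype.ext_iff.symm
  dist_comm x y := hd.comm _ _
  dist_triangle x y z := hd.triangle _ _ _
  dist_op f x y a b ha hb := by
    have := hd.op f (fun i => (x i : Q)) (fun i => (y i : Q))
    rwa [show funMap f (fun i => (x i : Q)) = a from ha,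
      show funMap f (fun i => (y i : Q)) = b from hb] at this

/-- The quotient of `D` by an ideal embeds in the quotient of `Q` by the corresponding congruence,
and the latter algebra belongs to `W`. -/
theorem inducedPregamp_isOf (Q : Alg W) (d : Q.carrier → Q.carrier → S) (hd : IsConDist L d)
    (D : Set Q.carrier) : (inducedPregamp d hd D).IsOf W := by
  intro I e he v a b ha hb
  let ψ := hd.idealCon I
  let h : (inducedPregamp d hd D).QuotCarrier I → (Q.quot ψ).carrier :=
    Quotient.lift (s := (inducedPregamp d hd D).idealSetoid I)
      (fun x : D => ψ.proj (x : Q.carrier)) fun x y hxy => AlgCon.proj_eq.2 hxy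
  have hop : ∀ {n : ℕ} (f : L.Functions n) x a, PartialAlgebra.op f x a →
      funMap f (fun i => h (x i)) = h a := by
    rintro n f x a ⟨y, b, hy, hyx, rfl⟩
    obtain rfl : _ = x := funext hyx
    refine (ψ.funMap_proj f fun i => @Subtype.val Q.carrier (· ∈ D) (y i)).trans ?_
    exact congrArg ψ.proj hy
  have hinj : Function.Injective h := by
    intro x y
    refine Quotient.inductionOn₂ x y fun x y hxy => ?_
    exact Quotient.sound (s := (inducedPregamp d hd D).idealSetoid I)
      ((AlgCon.proj_eq (θ := ψ)).1 hxy)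
  apply hinj
  rw [← EvalsTo.realize hop ha, ← EvalsTo.realize hop hb]
  exact he (Q.quot ψ) _

/-- The gamp on a subset `D` of an algebra with a distance, with a smaller subset `D'`. -/
def inducedGamp (Q : Alg W) (d : Q.carrier → Q.carrier → S) (hd : IsConDist L d)
    (D' D : Set Q.carrier) : Gamp W where
  toPregamp := inducedPregamp d hd D
  isOf := inducedPregamp_isOf Q d hd D
  star :=
    { carrier := {x : D | (x : Q.carrier) ∈ D'}
      dom := fun f => {x : Fin _ → D | (∀ i, (x i : Q.carrier) ∈ D') ∧
        ∃ a : D, (a : Q.carrier) ∈ D' ∧ funMap f (fun i => (x i : Q.carrier)) = a}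
      mem_of_dom := fun _ _ hx i => hx.1 i
      op_of_dom := fun _ _ hx => hx.2 }

section

variable (Q : Alg W) {d : Q.carrier → Q.carrier → S} (hd : IsConDist L d)
  {D' D : Set Q.carrier}

theorem inducedGamp_isStrong (h : ∀ {n : ℕ} (f : L.Functions n) (x : Fin n → Q.carrier),
    (∀ i, x i ∈ D') → funMap f x ∈ D) : (inducedGamp Q d hd D' D).IsStrong :=
  fun f _ hx => ⟨⟨_, h f _ hx⟩, rfl⟩

theorem inducedGamp_hasIsomorphicRealization :
    (inducedGamp Q d hd D' D).HasIsomorphicRealization := by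
  obtain ⟨χ, hχ, hd'⟩ := hd.exists_iso
  exact ⟨{ alg := Q
           incl := Subtype.val
           incl_injective := Subtype.val_injective
           incl_op := fun _ _ _ h => h
           χ := χ
           χ_injective := hχ.1
           χ_dist := fun x y => hd' _ _ }, hχ⟩

theorem inducedGamp_isDistanceGenerated (hD : D' ⊆ D)
    (h : ∀ s : S, ∃ F : Finset (Q.carrier × Q.carrier), (∀ p ∈ F, p.1 ∈ D' ∧ p.2 ∈ D') ∧
      s = F.sup fun p => d p.1 p.2) : (inducedGamp Q d hd D' D).IsDistanceGenerated := by
  classical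
  intro s
  obtain ⟨F, hF, rfl⟩ := h s
  let g : Fin F.card → F := F.equivFin.symm
  have key : (F.sup fun p => d p.1 p.2) =
      Finset.univ.sup fun k : Fin F.card => d (g k).1.1 (g k).1.2 := by
    refine le_antisymm (Finset.sup_le fun p hp => ?_) (Finset.sup_le fun k _ => ?_)
    · have := Finset.le_sup (f := fun k : Fin F.card => d (g k).1.1 (g k).1.2)
        (Finset.mem_univ (F.equivFin ⟨p, hp⟩))
      simpa [g] using this
    · exact Finset.le_sup (f := fun p : Q.carrier × Q.carrier => d p.1 p.2) (g k).2
  exact ⟨F.card, fun k => ⟨_, hD (hF _ (g k).2).1⟩, fun k => ⟨_, hD (hF _ (g k).2).2⟩,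
    fun k => (hF _ (g k).2).1, fun k => (hF _ (g k).2).2, key⟩

omit [L.IsAlgebraic] in
/-- The steps of Mal'cev chains are given by terms. -/
theorem Step.exists_term {E : Q.carrier → Q.carrier → Prop} {m : ℕ} {xs ys : Fin m → D}
    (hE : ∀ a b, E a b → ∃ i, (xs i : Q.carrier) = a ∧ (ys i : Q.carrier) = b)
    {a b : Q.carrier} (h : Step L D E a b) :
    ∃ (ha : a ∈ D) (hb : b ∈ D) (t : L.Term (Fin m ⊕ Fin m ⊕ D)),
      EvalsTo (Sum.elim xs (Sum.elim ys id)) t ⟨a, ha⟩ ∧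
      EvalsTo (Sum.elim ys (Sum.elim xs id)) t ⟨b, hb⟩ := by
  induction h with
  | base h =>
    obtain ⟨i, rfl, rfl⟩ := hE _ _ h
    exact ⟨(xs i).2, (ys i).2, .var (.inl i), rfl, rfl⟩
  | base_symm h =>
    obtain ⟨i, rfl, rfl⟩ := hE _ _ h
    exact ⟨(ys i).2, (xs i).2, .var (.inr (.inl i)), rfl, rfl⟩
  | refl u h => exact ⟨h, h, .var (.inr (.inr ⟨u, h⟩)), rfl, rfl⟩
  | op f u v _ h h' ih =>
    choose hu hv t ht ht' using ih
    exact ⟨h, h', .func f t, ⟨_, ht, rfl⟩, ⟨_, ht', rfl⟩⟩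

/-- Each step of a Mal'cev chain is the value of one term before and after exchanging the two blocks
of variables, with parameters in `D`. As `D` is finite, all of it can serve as the list of
parameters. -/
theorem inducedGamp_isCongruenceTractable (hfin : D.Finite)
    (h : ∀ E : Finset (Q.carrier × Q.carrier), (∀ p ∈ E, p.1 ∈ D' ∧ p.2 ∈ D') →
      ∀ x ∈ D', ∀ y ∈ D', d x y ≤ (E.sup fun p => d p.1 p.2) →
        Relation.ReflTransGen (Step L D fun a b => (a, b) ∈ E) x y) :
    (inducedGamp Q d hd D' D).IsCongruenceTractable := by
  classical
  intro m x y xs ys hx hy hxs hys hle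
  have hc := h (Finset.univ.image fun k => ((xs k : D).1, (ys k : D).1)) (by
    intro p hp
    obtain ⟨k, _, rfl⟩ := Finset.mem_image.1 hp
    exact ⟨hxs k, hys k⟩) (x : D).1 hx (y : D).1 hy (by rw [Finset.sup_image]; exact hle)
  have : Finite D := hfin
  obtain ⟨l, ⟨e⟩⟩ := Finite.exists_equiv_fin D
  have key : ∀ a : Q.carrier, Relation.ReflTransGen
      (Step L D fun a b => (a, b) ∈ Finset.univ.image fun k => ((xs k : D).1, (ys k : D).1)) a
      (y : D).1 → ∀ ha : a ∈ D, ∃ (n : ℕ) (t : ℕ → L.Term (Fin m ⊕ Fin m ⊕ D)), 0 < n ∧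
      EvalsTo (A := D) (Sum.elim xs (Sum.elim ys id)) (t 0) ⟨a, ha⟩ ∧
      EvalsTo (A := D) (Sum.elim xs (Sum.elim ys id)) (t n) y ∧
      ∀ k < n, ∃ a, EvalsTo (A := D) (Sum.elim ys (Sum.elim xs id)) (t k) a ∧
        EvalsTo (A := D) (Sum.elim xs (Sum.elim ys id)) (t (k + 1)) a := by
    intro a hay
    induction hay using Relation.ReflTransGen.head_induction_on with
    | refl =>
      intro ha
      -- The definition asks for `n ≥ 1`, so an empty chain is padded with a parameter as a constant
      -- term.
      exact ⟨1, fun _ => .var (.inr (.inr ⟨_, ha⟩)), one_pos, rfl, rfl, fun k _ => ⟨_, rfl, rfl⟩⟩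
    | head hs _ ih =>
      intro ha
      obtain ⟨_, hb, t, ht, ht'⟩ := Step.exists_term Q (xs := xs) (ys := ys) (by
        intro a b hab
        obtain ⟨k, _, hk⟩ := Finset.mem_image.1 hab
        exact ⟨k, congrArg Prod.fst hk, congrArg Prod.snd hk⟩) hs
      obtain ⟨n, t', _, h0, h1, h2⟩ := ih hb
      refine ⟨n + 1, fun k => Nat.casesOn k t t', n.succ_pos, ht, h1, ?_⟩
      rintro (_ | k) hk
      · exact ⟨_, ht', h0⟩
      · exact h2 k (Nat.lt_of_succ_lt_succ hk)
  obtain ⟨n, t, hn, h0, h1, h2⟩ := key _ hc (x : D).2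
  let r : Fin m ⊕ Fin m ⊕ D → Fin m ⊕ Fin m ⊕ Fin l := Sum.map id (Sum.map id e)
  have hr : ∀ p q : Fin m → D, Sum.elim p (Sum.elim q fun i => e.symm i) ∘ r =
      Sum.elim p (Sum.elim q id) := by
    intro p q
    funext i
    rcases i with i | i | i <;> simp [r]
  refine ⟨n, l, fun i => e.symm i, fun k => (t k).relabel r, hn, EvalsTo.relabel.2 ?_,
    EvalsTo.relabel.2 ?_, fun k hk => ?_⟩
  · exact (hr xs ys).symm ▸ h0
  · exact (hr xs ys).symm ▸ h1
  · obtain ⟨a, ha, ha'⟩ := h2 k hk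
    exact ⟨a, EvalsTo.relabel.2 ((hr ys xs).symm ▸ ha),
      EvalsTo.relabel.2 ((hr xs ys).symm ▸ ha')⟩

end

end Induced

/-- A morphism of semilattices, as a function. -/
abbrev semFun {X Y : SemilatSupCat.{u}} (f : X ⟶ Y) : SupBotHom X Y := f

theorem exists_sequence_of_reflTransGen {α : Type*} {r : α → α → Prop} {x y : α}
    (h : Relation.ReflTransGen r x y) :
    ∃ (n : ℕ) (z : ℕ → α), z 0 = x ∧ z n = y ∧ ∀ k < n, r (z k) (z (k + 1)) := by
  induction h using Relation.ReflTransGen.head_induction_on with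
  | refl => exact ⟨0, fun _ => y, rfl, rfl, fun k hk => absurd hk (Nat.not_lt_zero k)⟩
  | @head a c hs _ ih =>
    obtain ⟨n, z, h0, h1, h2⟩ := ih
    refine ⟨n + 1, fun k => Nat.casesOn k a z, rfl, h1, ?_⟩
    rintro (_ | k) hk
    · subst h0; exact hs
    · exact h2 k (Nat.lt_of_succ_lt_succ hk)

/-! ### From a coherent system of finite subsets to a partial lifting. -/

section Tower

variable {L : FirstOrder.Language.{u, u}} {W : Variety L}
  {T : Type w} [PartialOrder T]

/-- The elements of a set and the values of the operations at them. -/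
def opHull (L : FirstOrder.Language.{u, u}) {A : Type u} [L.Structure A] (D : Set A) : Set A :=
  D ∪ {a | ∃ (n : ℕ) (f : L.Functions n) (x : Fin n → A), (∀ i, x i ∈ D) ∧ funMap f x = a}

/-- Distances on an algebra, and subsets on which they are compatible with a diagram of
semilattices. -/
structure Tower (B : Alg W) (S : T ⥤ SemilatSupCat.{u}) where
  e : ∀ t, B.carrier → B.carrier → S.obj t
  isPre : ∀ t, IsPreConDist L (e t)
  inner : T → Set B.carrier
  outer : T → Set B.carrier
  finite_outer : ∀ t, (outer t).Finite
  inner_subset : ∀ t, opHull L (inner t) ⊆ outer t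
  outer_subset : ∀ {s t}, s < t → opHull L (outer s) ⊆ inner t
  -- Coherence is needed on the hull and not only on `outer s`: the transition maps must respect
  -- values of operations that fall outside `outer s`, since strong morphisms require those values
  -- later.
  coherent : ∀ {s t} (h : s ≤ t), ∀ b ∈ opHull L (outer s), ∀ b' ∈ opHull L (outer s),
    e t b b' = semFun (S.map (homOfLE h)) (e s b b')
  generated : ∀ t (s : S.obj t), ∃ F : Finset (B.carrier × B.carrier),
    (∀ p ∈ F, p.1 ∈ inner t ∧ p.2 ∈ inner t) ∧ s = F.sup fun p => e t p.1 p.2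
  cuttable : ∀ {s t}, s < t → ∀ (X : Finset (S.obj t)), ∀ x ∈ outer s, ∀ y ∈ outer s,
    e t x y ≤ X.sup id → Relation.ReflTransGen (fun a b => a ∈ (isPre t).ker.proj '' inner t ∧
      b ∈ (isPre t).ker.proj '' inner t ∧ ∃ s ∈ X, (isPre t).quotDist a b ≤ s)
      ((isPre t).ker.proj x) ((isPre t).ker.proj y)
  tractable : ∀ t, ∀ E : Finset ((isPre t).ker.Quot × (isPre t).ker.Quot),
    (∀ p ∈ E, p.1 ∈ (isPre t).ker.proj '' inner t ∧ p.2 ∈ (isPre t).ker.proj '' inner t) →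
      ∀ x ∈ (isPre t).ker.proj '' inner t, ∀ y ∈ (isPre t).ker.proj '' inner t,
        (isPre t).quotDist x y ≤ (E.sup fun p => (isPre t).quotDist p.1 p.2) →
        Relation.ReflTransGen
          (Step L ((isPre t).ker.proj '' outer t) fun a b => (a, b) ∈ E) x y

namespace Tower

variable {B : Alg W} {S : T ⥤ SemilatSupCat.{u}} (G : Tower B S)

theorem subset_opHull {A : Type u} [L.Structure A] (D : Set A) : D ⊆ opHull L D :=
  Set.subset_union_left

theorem inner_subset_outer (t : T) : G.inner t ⊆ G.outer t :=
  (subset_opHull _).trans (G.inner_subset t)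

theorem outer_mono {s t : T} (h : s ≤ t) : G.outer s ⊆ G.outer t := by
  obtain rfl | h := h.eq_or_lt
  · exact subset_rfl
  · exact ((subset_opHull _).trans (G.outer_subset h)).trans (G.inner_subset_outer t)

theorem inner_mono {s t : T} (h : s ≤ t) : G.inner s ⊆ G.inner t := by
  obtain rfl | h := h.eq_or_lt
  · exact subset_rfl
  · exact (G.inner_subset_outer s).trans ((subset_opHull _).trans (G.outer_subset h))

/-- The projection to the quotient by the kernel of a distance. -/
abbrev proj (t : T) : B.carrier → (G.isPre t).ker.Quot := (G.isPre t).ker.proj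

theorem proj_eq_of_le {s t : T} (h : s ≤ t) {b b' : B.carrier} (hb : b ∈ opHull L (G.outer s))
    (hb' : b' ∈ opHull L (G.outer s)) (hp : G.proj s b = G.proj s b') :
    G.proj t b = G.proj t b' := by
  refine AlgCon.proj_eq.2 ?_
  change G.e t b b' = ⊥
  rw [G.coherent h b hb b' hb', show G.e s b b' = ⊥ from AlgCon.proj_eq.1 hp, map_bot]

/-- The transition maps of the tower. -/
noncomputable def trans {s t : T} (h : s ≤ t) (x : G.proj s '' G.outer s) :
    G.proj t '' G.outer t :=
  ⟨G.proj t x.2.choose, _, G.outer_mono h x.2.choose_spec.1, rfl⟩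

/-- Elements of `outer s` identified at `s` stay identified at `t`, so the representative chosen in
`trans` is immaterial. -/
theorem trans_proj {s t : T} (h : s ≤ t) {b : B.carrier} (hb : b ∈ G.outer s)
    (x : G.proj s '' G.outer s) (hx : G.proj s b = x) : (G.trans h x : _) = G.proj t b :=
  G.proj_eq_of_le h (subset_opHull _ x.2.choose_spec.1) (subset_opHull _ hb)
    (x.2.choose_spec.2.trans hx.symm)

/-- Values of operations are preserved, even if they are outside of the set. -/
theorem funMap_trans {s t : T} (h : s ≤ t) {n : ℕ} (f : L.Functions n)
    (x : Fin n → G.proj s '' G.outer s) {b : B.carrier} (hb : b ∈ opHull L (G.outer s))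
    (hx : funMap f (fun i => (x i : (G.isPre s).ker.Quot)) = G.proj s b) :
    funMap f (fun i => (G.trans h (x i) : (G.isPre t).ker.Quot)) = G.proj t b := by
  choose c hc hcx using fun i => (x i).2
  have h1 : (fun i => (x i : (G.isPre s).ker.Quot)) = fun i => G.proj s (c i) :=
    funext fun i => (hcx i).symm
  have h2 : (fun i => (G.trans h (x i) : (G.isPre t).ker.Quot)) = fun i => G.proj t (c i) :=
    funext fun i => G.trans_proj h (hc i) _ (hcx i)
  rw [h1, AlgCon.funMap_proj] at hx
  rw [h2, AlgCon.funMap_proj]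
  exact G.proj_eq_of_le h (Or.inr ⟨n, f, c, hc, rfl⟩) hb hx

variable [L.IsAlgebraic]

/-- The gamps of the tower. -/
noncomputable def gamp (t : T) : Gamp W :=
  inducedGamp (B.quot (G.isPre t).ker) (G.isPre t).quotDist (G.isPre t).isConDist
    (G.proj t '' G.inner t) (G.proj t '' G.outer t)

/-- The transition morphisms of the tower. -/
noncomputable def hom {s t : T} (h : s ≤ t) : G.gamp s ⟶ G.gamp t where
  toFun := G.trans h
  semHom := semFun (S.map (homOfLE h))
  map_op f x a ha := by
    obtain ⟨b, hb, hba⟩ := a.2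
    refine (G.funMap_trans h f x (subset_opHull _ hb) (ha.trans hba.symm)).trans ?_
    exact (G.trans_proj h hb a hba).symm
  map_dist x y := by
    obtain ⟨b, hb, hbx⟩ := x.2
    obtain ⟨c, hc, hcy⟩ := y.2
    change (G.isPre t).quotDist (G.trans h x) (G.trans h y) =
      semFun (S.map (homOfLE h)) ((G.isPre s).quotDist x.1 y.1)
    rw [G.trans_proj h hb x hbx, G.trans_proj h hc y hcy, ← hbx, ← hcy]
    exact G.coherent h b (subset_opHull _ hb) c (subset_opHull _ hc)
  map_star := by
    rintro x ⟨b, hb, hbx⟩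
    exact ⟨b, G.inner_mono h hb, (G.trans_proj h (G.inner_subset_outer s hb) x hbx).symm⟩
  map_dom := by
    rintro n f x ⟨hx, a, ⟨b, hb, hba⟩, ha⟩
    refine ⟨fun i => ?_, ⟨G.proj t b, b, G.outer_mono h (G.inner_subset_outer s hb), rfl⟩,
      ⟨b, G.inner_mono h hb, rfl⟩, ?_⟩
    · obtain ⟨b, hb, hbx⟩ := hx i
      exact ⟨b, G.inner_mono h hb, (G.trans_proj h (G.inner_subset_outer s hb) _ hbx).symm⟩
    · exact G.funMap_trans h f x (subset_opHull _ (G.inner_subset_outer s hb)) (ha.trans hba.symm)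

/-- The diagram of gamps of the tower. -/
noncomputable def functor : T ⥤ Gamp W where
  obj := G.gamp
  map f := G.hom f.le
  map_id t := by
    apply GampHom.ext
    · funext x
      obtain ⟨b, hb, hbx⟩ := x.2
      exact Subtype.ext ((G.trans_proj le_rfl hb x hbx).trans hbx)
    · exact S.map_id t
  map_comp {r s t} f g := by
    apply GampHom.ext
    · funext x
      obtain ⟨b, hb, hbx⟩ := x.2
      refine Subtype.ext ((G.trans_proj (f ≫ g).le hb x hbx).trans (Eq.symm ?_))
      exact G.trans_proj g.le (G.outer_mono f.le hb) _ (G.trans_proj f.le hb x hbx).symm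
    · exact S.map_comp f g

/-- One application of an operation to `outer s` stays in `inner t`, so every operation on the image
has its value in the distinguished part of the next gamp. -/
theorem rangeInStar {s t : T} (h : s < t) : (G.hom h.le).RangeInStar ∧
    ∀ {n : ℕ} (f : L.Functions n) (x : Fin n → (G.gamp s).carrier),
      (fun i => (G.hom h.le).toFun (x i)) ∈ (G.gamp t).star.dom f := by
  have h1 : ∀ x : (G.gamp s).carrier, (G.hom h.le).toFun x ∈ (G.gamp t).star.carrier := by
    intro x
    obtain ⟨b, hb, hbx⟩ := x.2
    exact ⟨b, G.outer_subset h (subset_opHull _ hb), (G.trans_proj h.le hb x hbx).symm⟩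
  have h2 : ∀ {n : ℕ} (f : L.Functions n) (x : Fin n → (G.gamp s).carrier),
      (fun i => (G.hom h.le).toFun (x i)) ∈ (G.gamp t).star.dom f := by
    intro n f x
    choose c hc hcx using fun i => (x i).2
    have hm : funMap f c ∈ opHull L (G.outer s) := Or.inr ⟨n, f, c, hc, rfl⟩
    have hm' := G.outer_subset h hm
    refine ⟨fun i => h1 (x i), ⟨G.proj t (funMap f c), _, G.inner_subset_outer t hm', rfl⟩,
      ⟨_, hm', rfl⟩, ?_⟩
    refine G.funMap_trans h.le f x hm ?_
    refine Eq.trans ?_ (AlgCon.funMap_proj _ f c)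
    exact congrArg (funMap f) (funext fun i => (hcx i).symm)
  exact ⟨⟨h1, fun f x _ _ => h2 f x⟩, h2⟩

theorem isPartialLifting : IsPartialLifting G.functor where
  strong t := by
    refine inducedGamp_isStrong _ _ fun {n} f x hx => ?_
    choose c hc hcx using hx
    refine ⟨funMap f c, G.inner_subset t (Or.inr ⟨n, f, c, hc, rfl⟩), ?_⟩
    refine (AlgCon.funMap_proj _ f c).symm.trans ?_
    exact congrArg (funMap f) (funext hcx)
  congruenceTractable t :=
    inducedGamp_isCongruenceTractable _ _ ((G.finite_outer t).image _) (G.tractable t)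
  distanceGenerated t := by
    classical
    refine inducedGamp_isDistanceGenerated _ _ (Set.image_mono (G.inner_subset_outer t)) ?_
    intro s
    obtain ⟨F, hF, rfl⟩ := G.generated t s
    refine ⟨F.image fun p => (G.proj t p.1, G.proj t p.2), ?_, ?_⟩
    · intro p hp
      obtain ⟨q, hq, rfl⟩ := Finset.mem_image.1 hp
      exact ⟨⟨_, (hF q hq).1, rfl⟩, ⟨_, (hF q hq).2, rfl⟩⟩
    · rw [Finset.sup_image]
      rfl
  isomorphicRealization t := inducedGamp_hasIsomorphicRealization _ _
  map_strong s t h := G.rangeInStar h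
  map_cuttable s t h := by
    refine ⟨(G.rangeInStar h).1, fun X x y hle => ?_⟩
    obtain ⟨b, hb, hbx⟩ := x.2
    obtain ⟨c, hc, hcy⟩ := y.2
    have hx := G.trans_proj h.le hb x hbx
    have hy := G.trans_proj h.le hc y hcy
    have hle' : G.e t b c ≤ X.sup id := by
      have h1 : (G.isPre t).quotDist (G.trans h.le x) (G.trans h.le y) ≤ X.sup id := hle
      rwa [hx, hy] at h1
    obtain ⟨n, z, h0, h1, h2⟩ := exists_sequence_of_reflTransGen (G.cuttable h X b hb c hc hle')
    have hz : ∀ k ≤ n, z k ∈ G.proj t '' G.inner t := by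
      intro k hk
      obtain rfl | hk := hk.eq_or_lt
      · rw [h1]
        exact ⟨c, G.outer_subset h (subset_opHull _ hc), rfl⟩
      · exact (h2 k hk).1
    obtain ⟨z', hz'⟩ : ∃ z' : ℕ → G.proj t '' G.outer t, ∀ k ≤ n, (z' k).1 = z k := by
      refine ⟨fun k => if hk : k ≤ n then
        ⟨z k, Set.image_mono (G.inner_subset_outer t) (hz k hk)⟩ else G.trans h.le x, ?_⟩
      intro k hk
      exact congrArg Subtype.val (dif_pos hk)
    refine ⟨n, z', Subtype.ext ?_, Subtype.ext ?_, fun k hk => ?_, fun k hk => ?_⟩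
    · exact (hz' 0 (Nat.zero_le n)).trans (h0.trans hx.symm)
    · exact (hz' n le_rfl).trans (h1.trans hy.symm)
    · change (z' k).1 ∈ G.proj t '' G.inner t
      rw [hz' k hk]
      exact hz k hk
    · change ∃ s ∈ X, (G.isPre t).quotDist (z' k).1 (z' (k + 1)).1 ≤ s
      rw [hz' k hk.le, hz' (k + 1) hk]
      exact (h2 k hk).2.2

theorem hasPartialLifting (G : Tower B S) : HasPartialLifting W S :=
  ⟨G.functor, G.isPartialLifting, ⟨NatIso.ofComponents (fun _ => Iso.refl _) fun f => by
    rw [Iso.refl_hom, Iso.refl_hom]; rfl⟩⟩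

end Tower

end Tower

theorem exists_finite_of_reflTransGen {α : Type*} {r : α → α → Prop} {x y : α}
    (h : Relation.ReflTransGen r x y) :
    ∃ F : Set α, F.Finite ∧ Relation.ReflTransGen (fun a b => a ∈ F ∧ b ∈ F ∧ r a b) x y := by
  induction h with
  | refl => exact ⟨∅, Set.finite_empty, .refl⟩
  | @tail b c _ hs ih =>
    obtain ⟨F, hF, h⟩ := ih
    refine ⟨F ∪ {b, c}, hF.union (Set.toFinite _), .tail ?_ ⟨by simp, by simp, hs⟩⟩
    exact Relation.ReflTransGen.mono (fun _ _ h => ⟨Or.inl h.1, Or.inl h.2.1, h.2.2⟩) _ _ h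

/-! ### Finite sets of witnesses for a single gamp. -/

section Stage

variable {L : FirstOrder.Language.{u, u}} {S : Type u} [SemilatticeSup S] [OrderBot S]

/-- Inequalities between a distance and a finite join are witnessed by a path of short steps. -/
theorem IsConDist.exists_path {Q : Type u} [L.Structure Q] {d : Q → Q → S} (hd : IsConDist L d)
    (X : Finset S) (x y : Q) (h : d x y ≤ X.sup id) :
    Relation.ReflTransGen (fun a b => ∃ s ∈ X, d a b ≤ s) x y := by
  classical
  have hs : Std.Symm (fun a b => ∃ s ∈ X, d a b ≤ s) := ⟨fun a b h => by rwa [hd.comm]⟩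
  -- Connection by steps of length below elements of `X` is a congruence. It contains the generating
  -- pairs of every element of `X`, each such pair being one short step, so `tract` places `(x, y)`
  -- in it.
  let ψ : AlgCon L Q :=
    { r := Relation.ReflTransGen (fun a b => ∃ s ∈ X, d a b ≤ s)
      iseqv := ⟨fun _ => .refl, fun h => Std.Symm.symm _ _ h, .trans⟩
      map_rel := by
        intro n f x y h
        refine compatible_of_single (R := Relation.ReflTransGen (fun a b => ∃ s ∈ X, d a b ≤ s))
          ⟨fun _ => .refl, fun h => Std.Symm.symm _ _ h, .trans⟩ f ?_ x y h
        intro x i b hb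
        have : Relation.ReflTransGen (fun a b => ∃ s ∈ X, d a b ≤ s)
            (funMap f (Function.update x i (x i))) (funMap f (Function.update x i b)) := by
          refine hb.lift (fun c => funMap f (Function.update x i c)) ?_
          rintro c c' ⟨s, hs, hc⟩
          refine ⟨s, hs, (hd.op f _ _).trans (Finset.sup_le fun j _ => ?_)⟩
          by_cases hj : j = i
          · subst hj; simpa using hc
          · simp [Function.update_of_ne hj, (hd.eq_bot (x j) (x j)).2 rfl]
        simpa using this }
  choose F hF using hd.gen
  refine hd.tract (X.biUnion F) x y ?_ ψ ?_
  · refine h.trans (Finset.sup_le fun s hs => ?_)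
    rw [id]
    conv_lhs => rw [hF s]
    exact Finset.sup_mono (Finset.subset_biUnion_of_mem F hs)
  · intro p hp
    obtain ⟨s, hs, hp⟩ := Finset.mem_biUnion.1 hp
    refine .single ⟨s, hs, ?_⟩
    rw [hF s]
    exact Finset.le_sup (f := fun p : Q × Q => d p.1 p.2) hp

/-- This is where the finite similarity type enters: it keeps every stage finite while closing under
one application of the operations. -/
theorem opHull_finite [Finite (Σ n, L.Functions n)] {A : Type u} [L.Structure A] {D : Set A}
    (hD : D.Finite) : (opHull L D).Finite := by
  have : Finite D := hD
  refine hD.union ((Set.finite_range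
    fun p : Σ q : Σ n, L.Functions n, Fin q.1 → D => funMap p.1.2 fun i => (p.2 i : A)).subset ?_)
  rintro _ ⟨n, f, x, hx, rfl⟩
  exact ⟨⟨⟨n, f⟩, fun i => ⟨x i, hx i⟩⟩, rfl⟩

variable {B : Type u} [L.Structure B]

/-- The sets `D'` and `D` carry enough elements of an algebra with a distance to serve as a gamp
that extends `P`. -/
structure IsStage {e : B → B → S} (he : IsPreConDist L e) (P D' D : Set B) : Prop where
  finite : D.Finite
  subset_inner : opHull L P ⊆ D'
  inner_subset : opHull L D' ⊆ D
  generated : ∀ s : S, ∃ F : Finset (B × B), (∀ p ∈ F, p.1 ∈ D' ∧ p.2 ∈ D') ∧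
    s = F.sup fun p => e p.1 p.2
  cuttable : ∀ (X : Finset S), ∀ x ∈ P, ∀ y ∈ P, e x y ≤ X.sup id →
    Relation.ReflTransGen (fun a b => a ∈ he.ker.proj '' D' ∧ b ∈ he.ker.proj '' D' ∧
      ∃ s ∈ X, he.quotDist a b ≤ s) (he.ker.proj x) (he.ker.proj y)
  tractable : ∀ E : Finset (he.ker.Quot × he.ker.Quot),
    (∀ p ∈ E, p.1 ∈ he.ker.proj '' D' ∧ p.2 ∈ he.ker.proj '' D') →
      ∀ x ∈ he.ker.proj '' D', ∀ y ∈ he.ker.proj '' D',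
        he.quotDist x y ≤ (E.sup fun p => he.quotDist p.1 p.2) →
        Relation.ReflTransGen (Step L (he.ker.proj '' D) fun a b => (a, b) ∈ E) x y

theorem exists_finite_lift {α β : Type*} {f : α → β} (hf : Function.Surjective f) {F : Set β}
    (hF : F.Finite) : ∃ M : Set α, M.Finite ∧ f '' M = F := by
  choose g hg using hf
  refine ⟨g '' F, hF.image g, ?_⟩
  rw [← Set.image_comp]
  simp [hg]

/-- Each requirement has a finite witness, and the finiteness of `S` and `P` leaves finitely many
requirements. Paths between elements of `P` go into `D'`. Mal'cev computations for pairs from `D'`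
go only into the larger `D`, so no circularity arises. -/
theorem exists_isStage [L.IsAlgebraic] [Finite (Σ n, L.Functions n)] [Finite S] {e : B → B → S}
    (he : IsPreConDist L e) {P : Set B} (hP : P.Finite) :
    ∃ D' D : Set B, IsStage he P D' D := by
  classical
  have hd := he.isConDist
  choose F hF using he.gen
  have hcut : ∀ (X : Finset S) (x y : B), ∃ R : Set B, R.Finite ∧ (e x y ≤ X.sup id →
      Relation.ReflTransGen (fun a b => a ∈ he.ker.proj '' R ∧ b ∈ he.ker.proj '' R ∧
        ∃ s ∈ X, he.quotDist a b ≤ s) (he.ker.proj x) (he.ker.proj y)) := by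
    intro X x y
    by_cases h : e x y ≤ X.sup id
    · obtain ⟨G, hG, h'⟩ := exists_finite_of_reflTransGen
        (hd.exists_path X (he.ker.proj x) (he.ker.proj y) h)
      obtain ⟨R, hR, rfl⟩ := exists_finite_lift he.ker.proj_surjective hG
      exact ⟨R, hR, fun _ => h'⟩
    · exact ⟨∅, Set.finite_empty, fun h' => absurd h' h⟩
  choose R hR hcut using hcut
  have htr : ∀ (E : Finset (he.ker.Quot × he.ker.Quot)) (x y : he.ker.Quot),
      ∃ M : Set B, M.Finite ∧ (he.quotDist x y ≤ (E.sup fun p => he.quotDist p.1 p.2) →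
        Relation.ReflTransGen (Step L (he.ker.proj '' M) fun a b => (a, b) ∈ E) x y) := by
    intro E x y
    by_cases h : he.quotDist x y ≤ (E.sup fun p => he.quotDist p.1 p.2)
    · obtain ⟨G, hG, h'⟩ := exists_finite_chain (L := L) (E := fun a b => (a, b) ∈ E)
        (hd.tract E x y h _ fun p hp => AlgCon.subset_gen hp)
      obtain ⟨M, hM, rfl⟩ := exists_finite_lift he.ker.proj_surjective hG
      exact ⟨M, hM, fun _ => h'⟩
    · exact ⟨∅, Set.finite_empty, fun h' => absurd h' h⟩
  choose M hM htr using htr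
  let D' : Set B := opHull L P ∪ (⋃ s, ⋃ p ∈ F s, {p.1, p.2}) ∪ ⋃ X, ⋃ x ∈ P, ⋃ y ∈ P, R X x y
  have hD' : D'.Finite := by
    refine ((opHull_finite hP).union ?_).union ?_
    · exact Set.finite_iUnion fun s => (F s).finite_toSet.biUnion fun p _ => Set.toFinite _
    · exact Set.finite_iUnion fun X => hP.biUnion fun x _ => hP.biUnion fun y _ => hR X x y
  have hK : (he.ker.proj '' D').Finite := hD'.image _
  let K := hK.toFinset
  -- The image `K` of `D'` is finite, hence so is the collection of inequalities between distances
  -- of its elements that call for a chain.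
  refine ⟨D', opHull L D' ∪ ⋃ E ∈ (K ×ˢ K).powerset, ⋃ x ∈ K, ⋃ y ∈ K, M E x y, ?_⟩
  refine ⟨?_, ?_, Set.subset_union_left, ?_, ?_, ?_⟩
  · refine (opHull_finite hD').union ?_
    exact (Finset.finite_toSet _).biUnion fun E _ => K.finite_toSet.biUnion fun x _ =>
      K.finite_toSet.biUnion fun y _ => hM E x y
  · exact Set.subset_union_left.trans Set.subset_union_left
  · intro s
    refine ⟨F s, fun p hp => ?_, hF s⟩
    have : {p.1, p.2} ⊆ D' := by
      refine Set.Subset.trans ?_ (Set.subset_union_left.trans' Set.subset_union_right)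
      exact Set.subset_iUnion_of_subset s
        (Set.subset_biUnion_of_mem (u := fun p : B × B => ({p.1, p.2} : Set B)) hp)
    exact ⟨this (by simp), this (by simp)⟩
  · intro X x hx y hy h
    have : R X x y ⊆ D' := by
      refine Set.Subset.trans ?_ Set.subset_union_right
      refine Set.subset_iUnion_of_subset X ?_
      exact Set.subset_iUnion₂_of_subset x hx (Set.subset_iUnion₂_of_subset y hy subset_rfl)
    refine Relation.ReflTransGen.mono ?_ _ _ (hcut X x y h)
    exact fun a b h => ⟨Set.image_mono this h.1, Set.image_mono this h.2.1, h.2.2⟩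
  · intro E hE x hx y hy h
    have hE' : E ∈ (K ×ˢ K).powerset := Finset.mem_powerset.2 fun p hp =>
      Finset.mem_product.2 ⟨hK.mem_toFinset.2 (hE p hp).1, hK.mem_toFinset.2 (hE p hp).2⟩
    refine Relation.ReflTransGen.mono ?_ _ _ (htr E x y h)
    refine fun a b h => h.mono (Set.image_mono ?_) fun _ _ h => h
    refine Set.Subset.trans ?_ Set.subset_union_right
    exact Set.subset_iUnion₂_of_subset E hE' (Set.subset_iUnion₂_of_subset x
      (hK.mem_toFinset.2 hx) (Set.subset_iUnion₂_of_subset y (hK.mem_toFinset.2 hy) subset_rfl))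

end Stage

/-- Dependent choice along a well-founded order. -/
theorem exists_wellFounded_choice {T : Type w} [Preorder T] (hT : WellFoundedLT T) {α : Type v}
    (R : (t : T) → ((s : T) → s < t → α) → α → Prop) (h : ∀ t ih, ∃ a, R t ih a) :
    ∃ F : T → α, ∀ t, R t (fun s _ => F s) (F t) := by
  choose c hc using h
  refine ⟨hT.wf.fix c, fun t => ?_⟩
  conv => arg 3; rw [hT.wf.fix_eq]
  exact hc t _

theorem wellFoundedLT_of_finite_Iic {T : Type w} [PartialOrder T]
    (hT : ∀ t : T, (Set.Iic t).Finite) : WellFoundedLT T :=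
  StrictMono.wellFoundedLT (f := fun t => (Set.Iic t).ncard) fun _ t h =>
    Set.ncard_lt_ncard (Set.Iic_ssubset_Iic.2 h) (hT t)

/-! ### Condensates and the recursive choice of labels. -/

section Condensates

variable {L₁ L₂ : FirstOrder.Language.{u, u}} {V : Variety L₁}
  {T : Type w} [PartialOrder T]

/-- The value of a morphism of a variety. -/
abbrev algFun {A B : Alg V} (f : A ⟶ B) : A.carrier →[L₁] B.carrier := f

/-- A condensate of a diagram: a countable algebra with projections indexed by the labellings of
the indexing poset by natural numbers, compatible with the diagram for large labels. -/
structure Condensate (A : T ⥤ Alg V) where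
  alg : Alg V
  countable : Countable alg.carrier
  π : (T → ℕ) → ∀ t, alg.carrier →[L₁] (A.obj t).carrier
  surjective : ∀ g t, Function.Surjective (π g t)
  local_eq : ∀ g g' t, (∀ s ≤ t, g s = g' s) → π g t = π g' t
  -- The label at `s` itself is not constrained. Hence a bound that depends on a finite set built at
  -- `s` can still be met by labels chosen afterwards.
  exists_bound : ∀ c, ∃ N : T → ℕ, ∀ g {s t} (h : s ≤ t), (∀ r, s < r → r ≤ t → N r ≤ g r) →
    π g t c = algFun (A.map (homOfLE h)) (π g s c)

namespace Condensate

variable {A : T ⥤ Alg V} (C : Condensate A)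

theorem exists_bound_finset (F : Finset C.alg.carrier) : ∃ N : T → ℕ, ∀ c ∈ F, ∀ g {s t}
    (h : s ≤ t), (∀ r, s < r → r ≤ t → N r ≤ g r) →
    C.π g t c = algFun (A.map (homOfLE h)) (C.π g s c) := by
  choose N hN using C.exists_bound
  refine ⟨fun r => F.sup fun c => N c r, fun c hc g s t h hr => hN c g h fun r h1 h2 => ?_⟩
  exact (Finset.le_sup (f := fun c => N c r) hc).trans (hr r h1 h2)

/-- A compact congruence is generated by finitely many pairs, so it inherits a bound from the
elements that occur in them. -/
theorem exists_bound_conc (Φ : Set (Conc L₁ C.alg.carrier)) (hΦ : Φ.Finite) :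
    ∃ N : T → ℕ, ∀ θ ∈ Φ, ∀ g {s t}
    (h : s ≤ t), (∀ r, s < r → r ≤ t → N r ≤ g r) →
    Conc.map (C.π g t) θ = Conc.map (algFun (A.map (homOfLE h))) (Conc.map (C.π g s) θ) := by
  classical
  choose F hF using fun θ : Conc L₁ C.alg.carrier => θ.exists_finset
  obtain ⟨N, hN⟩ := C.exists_bound_finset
    (hΦ.toFinset.biUnion fun θ => (F θ).image Prod.fst ∪ (F θ).image Prod.snd)
  refine ⟨N, fun θ hθ g s t h hr => ?_⟩
  have key : ∀ p ∈ F θ, C.π g t p.1 = algFun (A.map (homOfLE h)) (C.π g s p.1) ∧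
      C.π g t p.2 = algFun (A.map (homOfLE h)) (C.π g s p.2) := by
    intro p hp
    refine ⟨hN p.1 ?_ g h hr, hN p.2 ?_ g h hr⟩
    · exact Finset.mem_biUnion.2 ⟨θ, hΦ.mem_toFinset.2 hθ,
        Finset.mem_union_left _ (Finset.mem_image_of_mem _ hp)⟩
    · exact Finset.mem_biUnion.2 ⟨θ, hΦ.mem_toFinset.2 hθ,
        Finset.mem_union_right _ (Finset.mem_image_of_mem _ hp)⟩
  rw [hF θ, Conc.map_sup_theta, Conc.map_sup_theta, map_finset_sup]
  refine Finset.sup_congr rfl fun p hp => ?_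
  rw [(key p hp).1, (key p hp).2]
  exact (Conc.map_theta _ _ _).symm

variable {W : Variety L₂}

/-- The semilattice of compact congruences of an algebra at an index. -/
abbrev concAt (A : T ⥤ Alg V) (t : T) : Type u := Conc L₁ (A.obj t).carrier

/-- The distance that a projection of the condensate induces on an algebra with the same compact
congruences. -/
def dist {B : Alg W} (χ : SupBotHom (Conc L₂ B.carrier) (Conc L₁ C.alg.carrier)) {t : T}
    (p : C.alg.carrier →[L₁] (A.obj t).carrier) (b b' : B.carrier) : concAt A t :=
  Conc.map p (χ (theta L₂ b b'))

theorem isPreConDist_dist {B : Alg W} {χ : SupBotHom (Conc L₂ B.carrier) (Conc L₁ C.alg.carrier)}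
    (hχ : Function.Bijective χ) {t : T} {p : C.alg.carrier →[L₁] (A.obj t).carrier}
    (hp : Function.Surjective p) : IsPreConDist L₂ (C.dist χ p) :=
  isPreConDist_of_surjective χ hχ p hp

/-- At each point the recursion records a label, the two finite sets and the bound imposed by the
outer set. The label exceeds the bounds recorded at all smaller points, which are finitely many.
This makes the distances coherent on all earlier sets. -/
theorem exists_tower [L₂.IsAlgebraic] [Finite (Σ n, L₂.Functions n)]
    (hT : ∀ t : T, (Set.Iic t).Finite) (hA : ∀ t, Finite (A.obj t))
    {B : Alg W} (χ : SupBotHom (Conc L₂ B.carrier) (Conc L₁ C.alg.carrier))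
    (hχ : Function.Bijective χ) : Nonempty (Tower B (A ⋙ concFunctor V)) := by
  classical
  have hwf := wellFoundedLT_of_finite_Iic hT
  obtain ⟨F, hF⟩ := exists_wellFounded_choice hwf
    (α := ℕ × Set B.carrier × Set B.carrier × (T → ℕ))
    (fun t ih a => (∀ s (h : s < t), (ih s h).2.2.1.Finite) →
      (∀ s (h : s < t), (ih s h).2.2.2 t ≤ a.1) ∧
      -- The full labelling is not known during the recursion, so the stage is required for every
      -- labelling with the prescribed values up to `t`; by `local_eq` they all give the same
      -- projection.
      (∀ g : T → ℕ, (∀ s (h : s < t), g s = (ih s h).1) → g t = a.1 →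
        IsStage (C.isPreConDist_dist hχ (C.surjective g t)) (⋃ (s) (h : s < t), (ih s h).2.2.1)
          a.2.1 a.2.2.1) ∧
      ∀ b ∈ opHull L₂ a.2.2.1, ∀ b' ∈ opHull L₂ a.2.2.1, ∀ g {s t} (h : s ≤ t),
        (∀ r, s < r → r ≤ t → a.2.2.2 r ≤ g r) →
        C.dist χ (C.π g t) b b' = Conc.map (algFun (A.map (homOfLE h))) (C.dist χ (C.π g s) b b'))
    (by
      intro t ih
      by_cases hfin : ∀ s (h : s < t), (ih s h).2.2.1.Finite
      swap
      -- The recursion must produce a value for any earlier data; if these contain an infinite set,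
      -- the requirement is vacuous.
      · exact ⟨⟨0, ∅, ∅, 0⟩, fun h => absurd h hfin⟩
      have hlt : {s | s < t}.Finite := (hT t).subset fun s h => le_of_lt h
      have := hlt.to_subtype
      let n : ℕ := hlt.toFinset.attach.sup fun s => (ih s.1 (hlt.mem_toFinset.1 s.2)).2.2.2 t
      let g₀ : T → ℕ := fun s => if h : s < t then (ih s h).1 else n
      have hP : (⋃ (s) (h : s < t), (ih s h).2.2.1).Finite :=
        hlt.biUnion' fun s hs => hfin s hs
      obtain ⟨D', D, hD⟩ := exists_isStage (C.isPreConDist_dist hχ (C.surjective g₀ t)) hP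
      have hO := opHull_finite (L := L₂) hD.finite
      obtain ⟨N, hN⟩ := C.exists_bound_conc
        ((fun p : B.carrier × B.carrier => χ (theta L₂ p.1 p.2)) ''
          (opHull L₂ D ×ˢ opHull L₂ D)) ((hO.prod hO).image _)
      refine ⟨⟨n, D', D, N⟩, fun _ => ⟨fun s hs => ?_, fun g hg hgt => ?_, ?_⟩⟩
      · exact Finset.le_sup (f := fun s : {s // s ∈ hlt.toFinset} =>
          (ih s.1 (hlt.mem_toFinset.1 s.2)).2.2.2 t)
          (Finset.mem_attach _ ⟨s, hlt.mem_toFinset.2 hs⟩)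
      · have hg₀ : C.π g₀ t = C.π g t := C.local_eq _ _ _ fun s hs => by
          obtain rfl | hs := hs.eq_or_lt
          · simp [g₀, hgt]
          · simp [g₀, hs, hg s hs]
        have hcongr : ∀ p q : C.alg.carrier →[L₁] (A.obj t).carrier, p = q →
            ∀ (hp : Function.Surjective p) (hq : Function.Surjective q),
            IsStage (C.isPreConDist_dist hχ hp) (⋃ (s) (h : s < t), (ih s h).2.2.1) D' D →
            IsStage (C.isPreConDist_dist hχ hq) (⋃ (s) (h : s < t), (ih s h).2.2.1) D' D := by
          rintro p _ rfl _ _ h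
          exact h
        exact hcongr _ _ hg₀ (C.surjective g₀ t) (C.surjective g t) hD
      · intro b hb b' hb' g s t h hr
        exact hN _ ⟨(b, b'), ⟨hb, hb'⟩, rfl⟩ g h hr)
  have hfin : ∀ t, (F t).2.2.1.Finite := by
    intro t
    induction t using hwf.induction with
    | _ t ih => exact ((hF t ih).2.1 (fun t => (F t).1) (fun _ _ => rfl) rfl).finite
  let g : T → ℕ := fun t => (F t).1
  have hst := fun t => (hF t fun s _ => hfin s).2.1 g (fun _ _ => rfl) rfl
  refine ⟨⟨fun t => C.dist χ (C.π g t), fun t => C.isPreConDist_dist hχ (C.surjective g t),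
    fun t => (F t).2.1, fun t => (F t).2.2.1, hfin, fun t => (hst t).inner_subset, ?_, ?_,
    fun t => (hst t).generated, ?_, fun t => (hst t).tractable⟩⟩
  · intro s t h
    refine Set.Subset.trans ?_ (hst t).subset_inner
    have : (F s).2.2.1 ⊆ ⋃ (s) (_ : s < t), (F s).2.2.1 :=
      Set.subset_iUnion₂_of_subset s h subset_rfl
    refine Set.union_subset_union this ?_
    rintro _ ⟨n, f, x, hx, rfl⟩
    exact ⟨n, f, x, fun i => this (hx i), rfl⟩
  · intro s t h b hb b' hb'
    refine (hF s fun s _ => hfin s).2.2 b hb b' hb' g h fun r h1 h2 => ?_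
    exact (hF r fun s _ => hfin s).1 s h1
  · intro s t h X x hx y hy hle
    have : (F s).2.2.1 ⊆ ⋃ (s) (_ : s < t), (F s).2.2.1 :=
      Set.subset_iUnion₂_of_subset s h subset_rfl
    exact (hst t).cuttable X x (this hx) y (this hy) hle

end Condensate

end Condensates

/-! ### Existence of countable condensates. -/

section Construction

variable {L : FirstOrder.Language.{u, u}} {V : Variety L}

/-- The subalgebras of a locally finite variety that are generated by countable sets are
countable. -/
theorem countable_closure (hV : IsLocallyFinite V) (A : Alg V) {Y : Set A.carrier}
    (hY : Y.Countable) : Countable (FirstOrder.Language.Substructure.closure L Y) := by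
  let U : L.Substructure A.carrier :=
    { carrier := ⋃ F ∈ {F : Set A.carrier | F.Finite ∧ F ⊆ Y},
        (FirstOrder.Language.Substructure.closure L F : Set A.carrier)
      fun_mem := by
        intro n f x hx
        simp only [Set.mem_iUnion] at hx
        choose F hF hx using hx
        refine Set.mem_biUnion (x := ⋃ i, F i) ⟨Set.finite_iUnion fun i => (hF i).1,
          Set.iUnion_subset fun i => (hF i).2⟩ ?_
        refine FirstOrder.Language.Substructure.fun_mem _ f x fun i => ?_
        exact FirstOrder.Language.Substructure.closure_mono (Set.subset_iUnion F i) (hx i) }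
  have hU : FirstOrder.Language.Substructure.closure L Y ≤ U := by
    refine FirstOrder.Language.Substructure.closure_le.2 fun y hy => ?_
    exact Set.mem_biUnion (x := {y}) ⟨Set.finite_singleton y, Set.singleton_subset_iff.2 hy⟩
      (FirstOrder.Language.Substructure.subset_closure rfl)
  have hc : (U : Set A.carrier).Countable := by
    refine (Set.countable_ofPred_finite_subset hY).biUnion fun F hF => ?_
    have := hV A _ (FirstOrder.Language.Substructure.fg_closure hF.1)
    exact (Set.toFinite _).countable
  exact (hc.mono hU).to_subtype

/-- A substructure of a member of a variety. -/
def Alg.sub [L.IsAlgebraic] (A : Alg V) (N : L.Substructure A.carrier) [Nonempty N] : Alg V where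
  carrier := N
  satisfies e he := (A.satisfies e he).of_injective N.subtype.toHom N.subtype.injective

variable {T : Type w} [PartialOrder T] (A : T ⥤ Alg V)

theorem algFun_map_map {r s t : T} (h : r ≤ s) (h' : s ≤ t) (x : (A.obj r).carrier) :
    algFun (A.map (homOfLE h')) (algFun (A.map (homOfLE h)) x) =
      algFun (A.map (homOfLE (h.trans h'))) x :=
  (DFunLike.congr_fun (show algFun (A.map (homOfLE h ≫ homOfLE h')) = _ from
    A.map_comp _ _) x).symm

theorem algFun_map_refl {t : T} (h : t ≤ t) (x : (A.obj t).carrier) :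
    algFun (A.map (homOfLE h)) x = x :=
  DFunLike.congr_fun (show algFun (A.map (𝟙 t)) = _ from A.map_id t) x

/-- A choice of elements that is compatible with a diagram indexed by a tree. -/
theorem exists_compatible (hT : IsLowerFiniteTree T) :
    ∃ c : ∀ t, (A.obj t).carrier, ∀ {s t} (h : s ≤ t), algFun (A.map (homOfLE h)) (c s) = c t := by
  have hwf := wellFoundedLT_of_finite_Iic fun t => (hT t).1
  -- Below each point of the tree lies a unique minimal point, and comparable points share it. A
  -- choice at the minimal points, pushed forward, is therefore compatible.
  have hroot : ∀ t : T, ∃ r ≤ t, ∀ s ≤ r, s = r := by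
    intro t
    obtain ⟨r, hr, hmin⟩ := hwf.wf.has_min (Set.Iic t) ⟨t, le_rfl⟩
    exact ⟨r, hr, fun s hs => (hs.eq_or_lt).resolve_right (hmin s (hs.trans hr))⟩
  choose root hle hmin using hroot
  have hroot_eq : ∀ {s t}, s ≤ t → root s = root t := by
    intro s t h
    rcases (hT t).2.total ((hle s).trans h) (hle t) with h' | h'
    · exact hmin t _ h'
    · exact (hmin s _ h').symm
  let c₀ : ∀ t, (A.obj t).carrier := fun t => Classical.arbitrary _
  refine ⟨fun t => algFun (A.map (homOfLE (hle t))) (c₀ (root t)), fun {s t} h => ?_⟩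
  rw [algFun_map_map]
  have : ∀ r r' (_ : r = r') (hr : r ≤ t) (hr' : r' ≤ t),
      algFun (A.map (homOfLE hr)) (c₀ r) = algFun (A.map (homOfLE hr')) (c₀ r') := by
    rintro r _ rfl _ _
    rfl
  exact this _ _ (hroot_eq h) _ _

/-- The families of elements of the algebras of a diagram, indexed by labellings. -/
def LabelFamily : Type (max u w) := ∀ (_ : T → ℕ) (t : T), (A.obj t).carrier

instance : L.Structure (LabelFamily A) where
  funMap f x := fun g t => funMap f fun i => x i g t
  RelMap _ _ := False

/-- The families that depend locally on the labelling and are compatible with the diagram for large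
labels. -/
def labelSubalgebra : L.Substructure (LabelFamily A) where
  carrier := {a | (∀ g g' t, (∀ s ≤ t, g s = g' s) → a g t = a g' t) ∧
    ∃ N : T → ℕ, ∀ g {s t} (h : s ≤ t), (∀ r, s < r → r ≤ t → N r ≤ g r) →
      a g t = algFun (A.map (homOfLE h)) (a g s)}
  fun_mem {n} f x hx := by
    choose hloc N hN using hx
    refine ⟨fun g g' t h => congrArg (funMap f) (funext fun i => hloc i g g' t h),
      fun r => Finset.univ.sup fun i => N i r, fun g s t h hr => ?_⟩
    refine Eq.trans ?_ ((algFun (A.map (homOfLE h))).map_fun f fun i => x i g s).symm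
    refine congrArg (funMap f) (funext fun i => hN i g h fun r h1 h2 => ?_)
    exact (Finset.le_sup (f := fun i => N i r) (Finset.mem_univ i)).trans (hr r h1 h2)

/-- Projections of families. -/
def labelProj [L.IsAlgebraic] (g : T → ℕ) (t : T) : labelSubalgebra A →[L] (A.obj t).carrier where
  toFun a := a.1 g t
  map_fun' _ _ := rfl
  map_rel' r := isEmptyElim r

open Classical in
/-- The family that has the value `v` at `t` for the labelling `p`. -/
theorem exists_labelFamily (hT : IsLowerFiniteTree T) (t : T) (p : T → ℕ)
    (v : (A.obj t).carrier) : ∃ a : labelSubalgebra A, ∀ g, (∀ s ≤ t, g s = p s) →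
      a.1 g t = v := by
  obtain ⟨c, hc⟩ := exists_compatible A hT
  -- The family carries `v` upward from `t` when the labelling agrees with `p` below `t`, and equals
  -- the compatible background `c` otherwise.
  let a : LabelFamily A := fun g u =>
    if h : t ≤ u ∧ ∀ s ≤ t, g s = p s then algFun (A.map (homOfLE h.1)) v else c u
  have hpos : ∀ g u (h : t ≤ u), (∀ s ≤ t, g s = p s) →
    a g u = algFun (A.map (homOfLE h)) v := fun g u h h' => dif_pos ⟨h, h'⟩
  have hneg : ∀ g u, ¬(t ≤ u ∧ ∀ s ≤ t, g s = p s) → a g u = c u := fun g u h => dif_neg h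
  -- The bound `p r + 1` excludes the only possible failure of compatibility, where the background
  -- value is used at `s` and the carried value at `u`.
  refine ⟨⟨a, fun g g' u hg => ?_, fun r => p r + 1, fun g s u h hr => ?_⟩, fun g hg => ?_⟩
  · by_cases h : t ≤ u ∧ ∀ s ≤ t, g s = p s
    · rw [hpos g u h.1 h.2, hpos g' u h.1 fun s hs => (hg s (hs.trans h.1)).symm.trans (h.2 s hs)]
    · rw [hneg g u h, hneg g' u fun h' => h ⟨h'.1, fun s hs =>
        (hg s (hs.trans h'.1)).trans (h'.2 s hs)⟩]
  · by_cases h1 : t ≤ s ∧ ∀ s ≤ t, g s = p s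
    · rw [hpos g s h1.1 h1.2, hpos g u (h1.1.trans h) h1.2, algFun_map_map]
    · have h2 : ¬(t ≤ u ∧ ∀ s ≤ t, g s = p s) := by
        rintro ⟨h2, h3⟩
        have hts : ¬ t ≤ s := fun hts => h1 ⟨hts, h3⟩
        -- Below `u` the tree is a chain, so `s < t ≤ u`. The label at `t` is then at least `p t +
        -- 1` but also equal to `p t`.
        rcases (hT u).2.total h2 h with h4 | h4
        · exact hts h4
        · have := hr t (h4.lt_of_ne fun e => hts e.ge) h2
          rw [h3 t le_rfl] at this
          exact Nat.not_succ_le_self _ this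
      rw [hneg g s h1, hneg g u h2, hc h]
  · exact (hpos g t le_rfl hg).trans (algFun_map_refl A _ v)

/-- Locality means that surjectivity at `t` is tested on labellings of the finite set below `t`.
Countably many families therefore suffice, and by local finiteness they generate a countable
algebra. -/
theorem exists_condensate [L.IsAlgebraic] (hV : IsLocallyFinite V) [Countable T]
    (hT : IsLowerFiniteTree T) (hA : ∀ t, Finite (A.obj t)) : Nonempty (Condensate A) := by
  classical
  -- The families live in a universe that also involves the one of `T`; countability of `T` allows a
  -- copy in the universe of the variety.
  have hsmall : Small.{u} T := Countable.toSmall T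
  have hsmall' : Small.{u} (LabelFamily A) :=
    inferInstanceAs (Small.{u} (∀ (_ : T → ℕ) (t : T), (A.obj t).carrier))
  obtain ⟨c, hc⟩ := exists_compatible A hT
  let c' : labelSubalgebra A := ⟨fun _ t => c t, fun _ _ _ _ => rfl, 0, fun _ _ _ h _ => (hc h).symm⟩
  let E := equivShrink.{u} (labelSubalgebra A)
  let _ : L.Structure (Shrink.{u} (labelSubalgebra A)) := E.inducedStructure
  let E' : labelSubalgebra A ≃[L] Shrink.{u} (labelSubalgebra A) := E.inducedStructureEquiv
  let π : ∀ (g : T → ℕ) t, Shrink.{u} (labelSubalgebra A) →[L] (A.obj t).carrier :=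
    fun g t => (labelProj A g t).comp E'.symm.toHom
  have hπ : ∀ g t a, π g t (E a) = a.1 g t := fun g t a =>
    congrArg (fun a : labelSubalgebra A => a.1 g t) (E.symm_apply_apply a)
  have hsat : ∀ e ∈ V, Satisfies (Shrink.{u} (labelSubalgebra A)) e := by
    intro e he v
    apply E.symm.injective
    refine Subtype.ext (funext fun g => funext fun t => ?_)
    have h := (A.obj t).satisfies e he (π g t ∘ v)
    rwa [FirstOrder.Language.HomClass.realize_term, FirstOrder.Language.HomClass.realize_term] at h
  let K : Alg V :=
    { carrier := Shrink.{u} (labelSubalgebra A)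
      nonempty := ⟨E c'⟩
      satisfies := hsat }
  let ext : ∀ t : T, (Set.Iic t → ℕ) → T → ℕ := fun t p s => if h : s ≤ t then p ⟨s, h⟩ else 0
  have hext : ∀ t (p : Set.Iic t → ℕ) s (hs : s ≤ t), ext t p s = p ⟨s, hs⟩ :=
    fun t p s hs => dif_pos hs
  choose a ha using fun i : Σ t : T, (Set.Iic t → ℕ) × (A.obj t).carrier =>
    exists_labelFamily A hT i.1 (ext i.1 i.2.1) i.2.2
  have hfin : ∀ t : T, Finite (Set.Iic t) := fun t => (hT t).1
  -- The element `E c'` keeps the generated algebra nonempty even when `T` is empty.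
  let Y : Set K.carrier := insert (E c') (Set.range fun i => E (a i))
  have hY : Y.Countable := (Set.countable_range _).insert _
  let N := FirstOrder.Language.Substructure.closure L Y
  have hYN : Y ⊆ N := FirstOrder.Language.Substructure.subset_closure
  have : Nonempty N := ⟨⟨E c', hYN (Or.inl rfl)⟩⟩
  refine ⟨⟨K.sub N, countable_closure hV K hY, fun g t => (π g t).comp N.subtype.toHom,
    fun g t v => ?_, fun g g' t h => ?_, fun x => ?_⟩⟩
  · refine ⟨⟨E (a ⟨t, fun s => g s, v⟩), hYN (Or.inr ⟨_, rfl⟩)⟩, ?_⟩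
    refine (hπ g t _).trans (ha ⟨t, fun s => g s, v⟩ g fun s hs => ?_)
    exact (hext t (fun s => g s) s hs).symm
  · refine FirstOrder.Language.Hom.ext fun x => ?_
    exact (E.symm x.1).2.1 g g' t h
  · exact (E.symm x.1).2.2

end Construction

/-- Diagrams of finite algebras have partial liftings if all the countable semilattices of the first
variety can be represented in the second one. -/
theorem hasPartialLifting_of_countable {L₁ L₂ : FirstOrder.Language.{u, u}} [L₁.IsAlgebraic]
    [L₂.IsAlgebraic] [Finite (Σ n, L₂.Functions n)] {V : Variety L₁} {W : Variety L₂}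
    (hV : IsLocallyFinite V)
    (h : ∀ S ∈ concClass V, Countable S → S ∈ concClass W)
    {T : Type w} [PartialOrder T] [Countable T] (hT : IsLowerFiniteTree T)
    (A : T ⥤ Alg V) (hA : ∀ t, Finite (A.obj t)) : HasPartialLifting W (A ⋙ concFunctor V) := by
  obtain ⟨C⟩ := exists_condensate A hV hT hA
  have := C.countable
  obtain ⟨B, ⟨i⟩⟩ := h ((concFunctor V).obj C.alg) ⟨C.alg, ⟨Iso.refl _⟩⟩
    (inferInstanceAs (Countable (Conc L₁ C.alg.carrier)))
  have hbij : Function.Bijective (semFun i.hom) := by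
    refine Function.bijective_iff_has_inverse.2 ⟨semFun i.inv, fun x => ?_, fun x => ?_⟩
    · exact DFunLike.congr_fun (show semFun (i.hom ≫ i.inv) = SupBotHom.id _ from i.hom_inv_id) x
    · exact DFunLike.congr_fun (show semFun (i.inv ≫ i.hom) = SupBotHom.id _ from i.inv_hom_id) x
  obtain ⟨G⟩ := C.exists_tower (fun t => (hT t).1) hA (semFun i.hom) hbij
  exact G.hasPartialLifting

/-! ### Terms, congruences and finitely many variables. -/

section Terms

variable {L : FirstOrder.Language.{u, u}}

theorem AlgCon.realize {A : Type u} [L.Structure A] (ψ : AlgCon L A) {α : Type*} {v v' : α → A}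
    (h : ∀ i, ψ.r (v i) (v' i)) (t : L.Term α) : ψ.r (t.realize v) (t.realize v') := by
  induction t with
  | var i => exact h i
  | func f ts ih => exact ψ.map_rel f _ _ ih

/-- Terms depend on finitely many variables. -/
theorem exists_realize_congr (t : L.Term ℕ) : ∃ N : ℕ, ∀ (A : Type u) [L.Structure A]
    (v v' : ℕ → A), (∀ i < N, v i = v' i) → t.realize v = t.realize v' := by
  induction t with
  | var i => exact ⟨i + 1, fun _ _ _ _ h => h i (Nat.lt_succ_self i)⟩
  | func f ts ih =>
    choose N hN using ih
    refine ⟨Finset.univ.sup N, fun A _ v v' h => congrArg (funMap f) (funext fun i => ?_)⟩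
    exact hN i A v v' fun k hk => h k (hk.trans_le (Finset.le_sup (Finset.mem_univ i)))

end Terms

/-! ### The colimit of a sequence of gamps. -/

section Colimit

variable {L : FirstOrder.Language.{u, u}} {W : Variety L} {U : Type u}
  [SemilatticeSup U] [OrderBot U]

/-- A sequence of gamps with a cocone on its sequence of semilattices that has the properties of a
colimit. -/
structure ColimitData (W : Variety L) (U : Type u) [SemilatticeSup U] [OrderBot U] where
  G : ℕ ⥤ Gamp W
  isPartialLifting : IsPartialLifting G
  j : ∀ n, SupBotHom (G.obj n).sem U
  j_map : ∀ {n m} (h : n ≤ m) s, j m (GampHom.semHom (G.map (homOfLE h)) s) = j n s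
  exists_j_eq : ∀ x, ∃ n s, j n s = x
  exists_le : ∀ n s s', j n s ≤ j n s' → ∃ (m : ℕ) (h : n ≤ m),
    GampHom.semHom (G.map (homOfLE h)) s ≤ GampHom.semHom (G.map (homOfLE h)) s'

namespace ColimitData

variable (C : ColimitData W U)

/-- The universe of the `n`th gamp. -/
abbrev car (n : ℕ) : Type u := (C.G.obj n).carrier

/-- The transition maps. -/
def fwd {n m : ℕ} (h : n ≤ m) : C.car n → C.car m := GampHom.toFun (C.G.map (homOfLE h))

theorem fwd_fwd {n m k : ℕ} (h : n ≤ m) (h' : m ≤ k) (x : C.car n) :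
    C.fwd h' (C.fwd h x) = C.fwd (h.trans h') x :=
  (congrArg (fun F : GampHom _ _ => F.toFun x)
    (show C.G.map (homOfLE h ≫ homOfLE h') = _ from C.G.map_comp _ _)).symm

theorem fwd_refl {n : ℕ} (h : n ≤ n) (x : C.car n) : C.fwd h x = x :=
  congrArg (fun F : GampHom _ _ => F.toFun x) (show C.G.map (𝟙 n) = _ from C.G.map_id n)

theorem fwd_op {n m : ℕ} (h : n ≤ m) {a : ℕ} (f : L.Functions a) (x : Fin a → C.car n)
    (y : C.car n) (hy : PartialAlgebra.op f x y) :
    PartialAlgebra.op f (fun i => C.fwd h (x i)) (C.fwd h y) :=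
  GampHom.map_op (C.G.map (homOfLE h)) f x y hy

theorem j_dist_fwd {n m : ℕ} (h : n ≤ m) (x y : C.car n) :
    C.j m ((C.G.obj m).dist (C.fwd h x) (C.fwd h y)) = C.j n ((C.G.obj n).dist x y) := by
  rw [← C.j_map h]
  exact congrArg _ (GampHom.map_dist (C.G.map (homOfLE h)) x y)

/-- The elements of all the gamps. -/
abbrev Pt : Type u := Σ n, C.car n

/-- The distance of elements of the gamps. -/
def pdist (p q : C.Pt) : U :=
  C.j (max p.1 q.1) ((C.G.obj _).dist (C.fwd (le_max_left _ _) p.2) (C.fwd (le_max_right _ _) q.2))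

theorem pdist_eq {p q : C.Pt} {k : ℕ} (hp : p.1 ≤ k) (hq : q.1 ≤ k) :
    C.pdist p q = C.j k ((C.G.obj k).dist (C.fwd hp p.2) (C.fwd hq q.2)) := by
  rw [pdist, ← C.j_dist_fwd (max_le hp hq), fwd_fwd, fwd_fwd]

theorem pdist_self (p : C.Pt) : C.pdist p p = ⊥ := by
  rw [C.pdist_eq le_rfl le_rfl, ((C.G.obj p.1).dist_eq_bot _ _).2 rfl, map_bot]

theorem pdist_comm (p q : C.Pt) : C.pdist p q = C.pdist q p := by
  rw [C.pdist_eq (le_max_left p.1 q.1) (le_max_right p.1 q.1),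
    C.pdist_eq (le_max_right p.1 q.1) (le_max_left p.1 q.1), (C.G.obj _).dist_comm]

theorem pdist_triangle (p q r : C.Pt) : C.pdist p q ≤ C.pdist p r ⊔ C.pdist r q := by
  have hp : p.1 ≤ max p.1 (max q.1 r.1) := le_max_left _ _
  have hq : q.1 ≤ max p.1 (max q.1 r.1) := (le_max_left _ _).trans (le_max_right _ _)
  have hr : r.1 ≤ max p.1 (max q.1 r.1) := (le_max_right _ _).trans (le_max_right _ _)
  rw [C.pdist_eq hp hq, C.pdist_eq hp hr, C.pdist_eq hr hq, ← map_sup]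
  exact OrderHomClass.mono _ ((C.G.obj _).dist_triangle _ _ _)

/-- Identification of the elements at distance `0`. -/
def setoid : Setoid C.Pt where
  r p q := C.pdist p q = ⊥
  iseqv := by
    refine ⟨C.pdist_self, fun {p q} h => (C.pdist_comm q p).trans h, fun {p q r} h h' => ?_⟩
    have := C.pdist_triangle p r q
    rwa [h, h', sup_bot_eq, le_bot_iff] at this

/-- The colimit of the gamps. -/
def Lim : Type u := Quotient C.setoid

/-- The canonical map of a gamp to the colimit. -/
def toLim (n : ℕ) (x : C.car n) : C.Lim := Quotient.mk C.setoid ⟨n, x⟩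

theorem pdist_le_of_equiv {p p' q q' : C.Pt} (h : C.pdist p p' = ⊥) (h' : C.pdist q q' = ⊥) :
    C.pdist p q ≤ C.pdist p' q' := by
  refine (C.pdist_triangle p q p').trans ?_
  rw [h, bot_sup_eq]
  refine (C.pdist_triangle p' q q').trans ?_
  rw [C.pdist_comm q' q, h', sup_bot_eq]

/-- The distance on the colimit. -/
def dist (x y : C.Lim) : U :=
  Quotient.liftOn₂ (s₁ := C.setoid) (s₂ := C.setoid) x y C.pdist fun p q p' q' h h' =>
    le_antisymm (C.pdist_le_of_equiv h h')
      (C.pdist_le_of_equiv ((C.pdist_comm p' p).trans h) ((C.pdist_comm q' q).trans h'))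

theorem dist_toLim {n m : ℕ} (x : C.car n) (y : C.car m) :
    C.dist (C.toLim n x) (C.toLim m y) = C.pdist ⟨n, x⟩ ⟨m, y⟩ := rfl

theorem dist_toLim_self {n : ℕ} (x y : C.car n) :
    C.dist (C.toLim n x) (C.toLim n y) = C.j n ((C.G.obj n).dist x y) := by
  rw [dist_toLim, C.pdist_eq (p := ⟨n, x⟩) (q := ⟨n, y⟩) (le_refl n) (le_refl n), fwd_refl,
    fwd_refl]

theorem dist_eq_bot (x y : C.Lim) : C.dist x y = ⊥ ↔ x = y := by
  refine Quotient.inductionOn₂ x y fun p q => ?_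
  exact ⟨fun h => Quotient.sound h, fun h => Quotient.exact h⟩

theorem toLim_fwd {n m : ℕ} (h : n ≤ m) (x : C.car n) : C.toLim m (C.fwd h x) = C.toLim n x := by
  rw [← dist_eq_bot, dist_toLim, C.pdist_eq (p := ⟨m, _⟩) (q := ⟨n, x⟩) (le_refl m) h, fwd_refl,
    ((C.G.obj m).dist_eq_bot _ _).2 rfl, map_bot]

/-- Finitely many elements of the colimit come from one gamp. -/
theorem exists_level {ι : Type*} [Finite ι] (x : ι → C.Lim) :
    ∃ (n : ℕ) (w : ι → C.car n), ∀ i, x i = C.toLim n (w i) := by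
  have := Fintype.ofFinite ι
  have hx : ∀ i, ∃ p : C.Pt, C.toLim p.1 p.2 = x i := fun i => Quotient.exists_rep (x i)
  choose p hp using hx
  refine ⟨Finset.univ.sup fun i => (p i).1,
    fun i => C.fwd (Finset.le_sup (f := fun i => (p i).1) (Finset.mem_univ i)) (p i).2,
    fun i => ?_⟩
  rw [toLim_fwd, hp]

/-- Strong morphisms complete every operation one stage later; this makes the colimit a total
algebra. -/
theorem exists_op_succ {n a : ℕ} (f : L.Functions a) (w : Fin a → C.car n) :
    ∃ y : C.car (n + 1), PartialAlgebra.op f (fun i => C.fwd n.le_succ (w i)) y := by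
  have h := (C.isPartialLifting.map_strong n (n + 1) n.lt_succ_self).2 f w
  obtain ⟨y, _, hy⟩ := (C.G.obj (n + 1)).star.op_of_dom f _ h
  exact ⟨y, hy⟩

theorem exists_op {a : ℕ} (f : L.Functions a) (x : Fin a → C.Lim) :
    ∃ (y : C.Lim) (n : ℕ) (w : Fin a → C.car n) (z : C.car n), PartialAlgebra.op f w z ∧
      (∀ i, x i = C.toLim n (w i)) ∧ y = C.toLim n z := by
  obtain ⟨n, w, hw⟩ := C.exists_level x
  obtain ⟨z, hz⟩ := C.exists_op_succ f w
  exact ⟨_, n + 1, _, z, hz, fun i => by rw [toLim_fwd, hw], rfl⟩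

noncomputable instance : L.Structure C.Lim where
  funMap f x := (C.exists_op f x).choose
  RelMap _ _ := False

/-- Both values can be compared at a common stage. When the arguments agree in the colimit the bound
is zero, so the operation chosen there is independent of stage and representatives. -/
theorem dist_op_le {a : ℕ} (f : L.Functions a) {n m : ℕ} {w : Fin a → C.car n} {z : C.car n}
    {w' : Fin a → C.car m} {z' : C.car m} (h : PartialAlgebra.op f w z)
    (h' : PartialAlgebra.op f w' z') : C.dist (C.toLim n z) (C.toLim m z') ≤
      Finset.univ.sup fun i => C.dist (C.toLim n (w i)) (C.toLim m (w' i)) := by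
  have hn := le_max_left n m
  have hm := le_max_right n m
  have := OrderHomClass.mono (C.j _)
    ((C.G.obj (max n m)).dist_op f _ _ _ _ (C.fwd_op hn f w z h) (C.fwd_op hm f w' z' h'))
  rw [map_finset_sup, ← C.dist_toLim_self, toLim_fwd, toLim_fwd] at this
  refine this.trans (Finset.sup_mono_fun fun i _ => ?_)
  change C.j _ _ ≤ _
  rw [← C.dist_toLim_self, toLim_fwd, toLim_fwd]

theorem exists_funMap_eq {a : ℕ} (f : L.Functions a) (x : Fin a → C.Lim) :
    ∃ (n : ℕ) (w : Fin a → C.car n) (z : C.car n), PartialAlgebra.op f w z ∧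
      (∀ i, x i = C.toLim n (w i)) ∧ funMap f x = C.toLim n z :=
  (C.exists_op f x).choose_spec

theorem dist_funMap_le {a : ℕ} (f : L.Functions a) (x y : Fin a → C.Lim) :
    C.dist (funMap f x) (funMap f y) ≤ Finset.univ.sup fun i => C.dist (x i) (y i) := by
  obtain ⟨n, w, z, ho, hx, hz⟩ := C.exists_funMap_eq f x
  obtain ⟨m, w', z', ho', hy, hz'⟩ := C.exists_funMap_eq f y
  rw [hz, hz']
  simp only [hx, hy]
  exact C.dist_op_le f ho ho'

theorem funMap_toLim {a : ℕ} (f : L.Functions a) {n : ℕ} (w : Fin a → C.car n) (z : C.car n)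
    (h : PartialAlgebra.op f w z) : funMap f (fun i => C.toLim n (w i)) = C.toLim n z := by
  obtain ⟨m, w', z', ho, hx, hz⟩ := C.exists_funMap_eq f fun i => C.toLim n (w i)
  rw [hz, ← dist_eq_bot, ← le_bot_iff]
  refine (C.dist_op_le f ho h).trans (Finset.sup_le fun i _ => ?_)
  rw [← hx, (C.dist_eq_bot _ _).2 rfl]

/-- Every term is defined at a late stage of the sequence. -/
theorem exists_evalsTo {α : Type*} {n : ℕ} (w : α → C.car n) (t : L.Term α) :
    ∃ (m : ℕ) (h : n ≤ m) (z : C.car m), EvalsTo (fun i => C.fwd h (w i)) t z := by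
  induction t with
  | var i => exact ⟨n, le_rfl, _, rfl⟩
  | @func a f ts ih =>
    choose m h z hz using ih
    let k := max n (Finset.univ.sup m)
    have hm : ∀ i, m i ≤ k := fun i =>
      (Finset.le_sup (f := m) (Finset.mem_univ i)).trans (le_max_right _ _)
    obtain ⟨y, hy⟩ := C.exists_op_succ f fun i => C.fwd (hm i) (z i)
    refine ⟨k + 1, (le_max_left _ _).trans k.le_succ, y, _, fun i => ?_, hy⟩
    have := EvalsTo.map (C.fwd_op k.le_succ) (EvalsTo.map (C.fwd_op (hm i)) (hz i))
    simpa only [fwd_fwd] using this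

/-- In the quotient by the zero ideal both sides of the identity coincide, and distance zero means
equality. -/
theorem eq_of_evalsTo {e : Identity L} (he : e ∈ W) {n : ℕ} {w : ℕ → C.car n} {a b : C.car n}
    (ha : EvalsTo w e.1 a) (hb : EvalsTo w e.2 b) : a = b := by
  let I : Order.Ideal (C.G.obj n).sem := Order.Ideal.principal ⊥
  have hq : ∀ {c : ℕ} (f : L.Functions c) (x : Fin c → C.car n) (z : C.car n),
      PartialAlgebra.op f x z → PartialAlgebra.op (A := (C.G.obj n).QuotCarrier I) f
        (fun i => (C.G.obj n).toQuot I (x i)) ((C.G.obj n).toQuot I z) :=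
    fun f x z h => ⟨x, z, h, fun _ => rfl, rfl⟩
  have h := (C.G.obj n).isOf I e (fun A => A.satisfies e he) _ _ _
    (EvalsTo.map (B := (C.G.obj n).QuotCarrier I) (h := (C.G.obj n).toQuot I) hq ha)
    (EvalsTo.map (B := (C.G.obj n).QuotCarrier I) (h := (C.G.obj n).toQuot I) hq hb)
  have h' : (C.G.obj n).dist a b ∈ I := Quotient.exact (s := (C.G.obj n).idealSetoid I) h
  exact ((C.G.obj n).dist_eq_bot a b).1 (le_bot_iff.1 h')

theorem satisfies (e : Identity L) (he : e ∈ W) : Satisfies C.Lim e := by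
  intro v
  obtain ⟨N₁, h₁⟩ := exists_realize_congr e.1
  obtain ⟨N₂, h₂⟩ := exists_realize_congr e.2
  -- Finitely many variables are lifted to one gamp. The extra index guarantees that `w 0` exists as
  -- the value of the irrelevant variables.
  obtain ⟨n, w, hw⟩ := C.exists_level fun i : Fin (max N₁ N₂ + 1) => v i
  let w' : ℕ → C.car n := fun i => if h : i < max N₁ N₂ + 1 then w ⟨i, h⟩ else w 0
  have hw' : ∀ i < max N₁ N₂, v i = C.toLim n (w' i) := by
    intro i hi
    have hi' : i < max N₁ N₂ + 1 := hi.trans (Nat.lt_succ_self _)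
    rw [show w' i = w ⟨i, hi'⟩ from dif_pos hi', ← hw]
  rw [h₁ C.Lim v (fun i => C.toLim n (w' i)) fun i hi => hw' i (hi.trans_le (le_max_left _ _)),
    h₂ C.Lim v (fun i => C.toLim n (w' i)) fun i hi => hw' i (hi.trans_le (le_max_right _ _))]
  obtain ⟨m₁, hm₁, a, ha⟩ := C.exists_evalsTo w' e.1
  obtain ⟨m₂, hm₂, b, hb⟩ := C.exists_evalsTo w' e.2
  have ha' := EvalsTo.map (C.fwd_op (le_max_left m₁ m₂)) ha
  have hb' := EvalsTo.map (C.fwd_op (le_max_right m₁ m₂)) hb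
  simp only [fwd_fwd] at ha' hb'
  have hab := C.eq_of_evalsTo he ha' hb'
  have ha'' := EvalsTo.realize (fun f x a h => C.funMap_toLim f x a h) ha'
  have hb'' := EvalsTo.realize (fun f x a h => C.funMap_toLim f x a h) hb'
  simp only [toLim_fwd] at ha'' hb''
  rw [ha'', hb'', ← C.toLim_fwd (le_max_left m₁ m₂), ← C.toLim_fwd (le_max_right m₁ m₂), hab]

/-- An inequality of distances in the colimit already holds at some stage. There
congruence-tractability supplies a Mal'cev chain of terms, and its image in the colimit connects `x`
to `y` modulo `ψ`. -/
theorem tract (F : Finset (C.Lim × C.Lim)) (x y : C.Lim)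
    (h : C.dist x y ≤ F.sup fun p => C.dist p.1 p.2) (ψ : AlgCon L C.Lim)
    (hψ : ∀ p ∈ F, ψ.r p.1 p.2) : ψ.r x y := by
  let g : Fin F.card → F := F.equivFin.symm
  obtain ⟨n, w, hw⟩ := C.exists_level (ι := Bool ⊕ Fin F.card ⊕ Fin F.card)
    (Sum.elim (fun b => if b then x else y) (Sum.elim (fun k => (g k).1.1) fun k => (g k).1.2))
  let x₀ := w (.inl true)
  let y₀ := w (.inl false)
  let xs₀ := fun k => w (.inr (.inl k))
  let ys₀ := fun k => w (.inr (.inr k))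
  have hx : x = C.toLim n x₀ := by simpa using hw (.inl true)
  have hy : y = C.toLim n y₀ := by simpa using hw (.inl false)
  have hxs : ∀ k, (g k).1.1 = C.toLim n (xs₀ k) := fun k => hw (.inr (.inl k))
  have hys : ∀ k, (g k).1.2 = C.toLim n (ys₀ k) := fun k => hw (.inr (.inr k))
  have h1 : C.j n ((C.G.obj n).dist x₀ y₀) ≤
      C.j n (Finset.univ.sup fun k => (C.G.obj n).dist (xs₀ k) (ys₀ k)) := by
    rw [← C.dist_toLim_self, ← hx, ← hy]
    refine h.trans (Finset.sup_le fun p hp => ?_)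
    have hk : g (F.equivFin ⟨p, hp⟩) = ⟨p, hp⟩ := F.equivFin.symm_apply_apply _
    have h2 := OrderHomClass.mono (C.j n) (Finset.le_sup
      (f := fun k => (C.G.obj n).dist (xs₀ k) (ys₀ k)) (Finset.mem_univ (F.equivFin ⟨p, hp⟩)))
    rw [← C.dist_toLim_self, ← hxs, ← hys, hk] at h2
    exact h2
  obtain ⟨m, hm, h2⟩ := C.exists_le n _ _ h1
  -- Tractability applies only to elements of the distinguished part; one further stage moves all
  -- the elements there.
  have hs := (C.isPartialLifting.map_strong m (m + 1) m.lt_succ_self).1.1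
  have hnm : n ≤ m + 1 := hm.trans m.le_succ
  have hstar : ∀ z : C.car n, C.fwd hnm z ∈ (C.G.obj (m + 1)).star.carrier := by
    intro z
    rw [← C.fwd_fwd hm m.le_succ]
    exact hs _
  have h3 : (C.G.obj (m + 1)).dist (C.fwd hnm x₀) (C.fwd hnm y₀) ≤
      Finset.univ.sup fun k => (C.G.obj (m + 1)).dist (C.fwd hnm (xs₀ k)) (C.fwd hnm (ys₀ k)) := by
    rw [map_finset_sup] at h2
    have h4 := OrderHomClass.mono (GampHom.semHom (C.G.map (homOfLE m.le_succ))) h2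
    rw [map_finset_sup] at h4
    have h5 : ∀ a b : C.car n, GampHom.semHom (C.G.map (homOfLE m.le_succ))
        (GampHom.semHom (C.G.map (homOfLE hm)) ((C.G.obj n).dist a b)) =
          (C.G.obj (m + 1)).dist (C.fwd hnm a) (C.fwd hnm b) := by
      intro a b
      rw [← GampHom.map_dist, ← GampHom.map_dist, ← C.fwd_fwd hm m.le_succ,
        ← C.fwd_fwd hm m.le_succ]
      rfl
    rw [h5] at h4
    refine h4.trans (Finset.sup_mono_fun fun k _ => (h5 _ _).le)
  obtain ⟨c, l, zs, t, _, e0, e1, e2⟩ := C.isPartialLifting.congruenceTractable (m + 1) F.card _ _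
    _ _ (hstar x₀) (hstar y₀) (fun k => hstar (xs₀ k)) (fun k => hstar (ys₀ k)) h3
  have hop : ∀ {a : ℕ} (f : L.Functions a) (x : Fin a → C.car (m + 1)) (z : C.car (m + 1)),
    PartialAlgebra.op f x z → funMap f (fun i => C.toLim (m + 1) (x i)) = C.toLim (m + 1) z :=
      fun f x a h => C.funMap_toLim f x a h
  have key : ∀ k ≤ c, ψ.r x ((t k).realize fun i => C.toLim (m + 1) (Sum.elim
      (fun k => C.fwd hnm (xs₀ k)) (Sum.elim (fun k => C.fwd hnm (ys₀ k)) zs) i)) := by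
    intro k hk
    induction k with
    | zero =>
      rw [EvalsTo.realize hop e0, toLim_fwd, ← hx]
    | succ k ih =>
      -- Exchanging the two blocks of arguments changes a term's value only modulo `ψ`, and the
      -- exchanged value of one term is the value of the next.
      refine ψ.iseqv.trans (ih (Nat.le_of_succ_le hk)) ?_
      obtain ⟨a, ha, ha'⟩ := e2 k hk
      rw [EvalsTo.realize hop ha', ← EvalsTo.realize hop ha]
      refine ψ.realize (fun i => ?_) _
      rcases i with i | i | i
      · simp only [Sum.elim_inl, toLim_fwd]
        rw [← hxs, ← hys]
        exact hψ _ (g i).2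
      · simp only [Sum.elim_inl, Sum.elim_inr, toLim_fwd]
        rw [← hxs, ← hys]
        exact ψ.iseqv.symm (hψ _ (g i).2)
      · exact ψ.iseqv.refl _
  have hc := key c le_rfl
  rwa [EvalsTo.realize hop e1, toLim_fwd, ← hy] at hc

theorem isConDist : IsConDist L C.dist where
  eq_bot := C.dist_eq_bot
  comm x y := Quotient.inductionOn₂ x y C.pdist_comm
  triangle x y z := Quotient.inductionOn₃ x y z C.pdist_triangle
  op f x y := C.dist_funMap_le f x y
  tract := C.tract
  gen s := by
    classical
    obtain ⟨n, s, rfl⟩ := C.exists_j_eq s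
    obtain ⟨c, x, y, _, _, rfl⟩ := C.isPartialLifting.distanceGenerated n s
    refine ⟨Finset.univ.image fun k => (C.toLim n (x k), C.toLim n (y k)), ?_⟩
    rw [Finset.sup_image, map_finset_sup]
    refine Finset.sup_congr rfl fun k _ => ?_
    exact (C.dist_toLim_self _ _).symm

end ColimitData

/-- The one-element algebra. -/
def Alg.trivial (W : Variety L) : Alg W :=
  letI : L.Structure PUnit.{u + 1} := { funMap := fun _ _ => ⟨⟩, RelMap := fun _ _ => False }
  { carrier := PUnit
    satisfies := fun _ _ _ => rfl }

theorem ColimitData.exists_isConDist (C : ColimitData W U) :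
    ∃ (B : Alg W) (d : B.carrier → B.carrier → U), IsConDist L d := by
  by_cases h : Nonempty C.Lim
  · exact ⟨{ carrier := C.Lim, satisfies := C.satisfies }, C.dist, C.isConDist⟩
  -- The gamps may all be empty, whereas algebras may not. In that case there are no distances, the
  -- semilattice is trivial, and the one-element algebra represents it.
  · have hU : ∀ s : U, s = ⊥ := by
      intro s
      obtain ⟨F, rfl⟩ := C.isConDist.gen s
      refine le_bot_iff.1 (Finset.sup_le fun p _ => ?_)
      exact absurd ⟨p.1⟩ h
    refine ⟨Alg.trivial W, fun _ _ => ⊥, ⟨fun x y => ⟨fun _ => rfl, fun _ => rfl⟩, fun _ _ => rfl,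
      fun _ _ _ => bot_le, fun _ _ _ => bot_le, fun F x y _ ψ _ => ψ.iseqv.refl x,
      fun s => ⟨∅, hU s⟩⟩⟩

end Colimit

/-! ### Approximation by finite subalgebras. -/

section Chains

variable {L : FirstOrder.Language.{u, u}}

section

variable {A : Type u} [L.Structure A]

/-- Mal'cev chains in a substructure. -/
theorem Step.exists_rel {M : L.Substructure A} {φ : AlgCon L M} {D : Set A} (hD : D ⊆ M)
    {E : A → A → Prop} (hE : ∀ a b, E a b → ∃ (ha : a ∈ M) (hb : b ∈ M), φ.r ⟨a, ha⟩ ⟨b, hb⟩)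
    {a b : A} (h : Step L D E a b) : ∃ (ha : a ∈ M) (hb : b ∈ M), φ.r ⟨a, ha⟩ ⟨b, hb⟩ := by
  induction h with
  | base h => exact hE _ _ h
  | base_symm h =>
    obtain ⟨ha, hb, h⟩ := hE _ _ h
    exact ⟨hb, ha, φ.iseqv.symm h⟩
  | refl u h => exact ⟨hD h, hD h, φ.iseqv.refl _⟩
  | op f u v _ h h' ih =>
    choose hu hv hr using ih
    exact ⟨hD h, hD h', φ.map_rel f (fun i => ⟨u i, hu i⟩) (fun i => ⟨v i, hv i⟩) hr⟩

theorem exists_rel_of_chain {M : L.Substructure A} {φ : AlgCon L M} {D : Set A} (hD : D ⊆ M)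
    {E : A → A → Prop} (hE : ∀ a b, E a b → ∃ (ha : a ∈ M) (hb : b ∈ M), φ.r ⟨a, ha⟩ ⟨b, hb⟩)
    {a b : A} (h : Relation.ReflTransGen (Step L D E) a b) (ha : a ∈ M) :
    ∃ hb : b ∈ M, φ.r ⟨a, ha⟩ ⟨b, hb⟩ := by
  induction h with
  | refl => exact ⟨ha, φ.iseqv.refl _⟩
  | tail _ hs ih =>
    obtain ⟨hb, h⟩ := ih
    obtain ⟨_, hc, h'⟩ := Step.exists_rel hD hE hs
    exact ⟨hc, φ.iseqv.trans h h'⟩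

/-- The inclusion of a substructure, on compact congruences. -/
abbrev subConc (M : L.Substructure A) : SupBotHom (Conc L M) (Conc L A) :=
  Conc.map M.subtype.toHom

/-- The inclusion of a substructure in a larger one, on compact congruences. -/
abbrev inclConc {M M' : L.Substructure A} (h : M ≤ M') : SupBotHom (Conc L M) (Conc L M') :=
  Conc.map (FirstOrder.Language.Substructure.inclusion h).toHom

theorem subConc_inclConc {M M' : L.Substructure A} (h : M ≤ M') (θ : Conc L M) :
    subConc M' (inclConc h θ) = subConc M θ := by
  obtain ⟨F, rfl⟩ := θ.exists_finset
  rw [subConc, inclConc, Conc.map_sup_theta, Conc.map_sup_theta, map_finset_sup]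
  refine Finset.sup_congr rfl fun p _ => ?_
  exact Conc.map_theta _ _ _

/-- Inequalities between compact congruences of a finite subalgebra that hold in the whole algebra
hold in a large enough finitely generated subalgebra. -/
theorem exists_finite_inclConc_le (M : L.Substructure A) [Finite M] :
    ∃ F : Set A, F.Finite ∧ ∀ (M' : L.Substructure A) (h : M ≤ M'), F ⊆ M' →
      ∀ θ ψ : Conc L M, subConc M θ ≤ subConc M ψ → inclConc h θ ≤ inclConc h ψ := by
  classical
  -- For each instance of an inequality in `A`, a finite Mal'cev computation is a witness that
  -- remains valid in any subalgebra containing it. As `M` is finite, there are finitely many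
  -- instances.
  have key : ∀ (θ ψ : Conc L M) (x y : M), ∃ F : Set A, F.Finite ∧
      (subConc M θ ≤ subConc M ψ → θ.1.r x y → Relation.ReflTransGen
        (Step L F fun a b => ∃ x y, ψ.1.r x y ∧ (x : A) = a ∧ (y : A) = b) x y) := by
    intro θ ψ x y
    by_cases h : subConc M θ ≤ subConc M ψ ∧ θ.1.r x y
    · have h' : (subConc M ψ).1.r x y :=
        (AlgCon.gc_map_comap M.subtype.toHom θ.1 _).1 h.1 x y h.2
      obtain ⟨F, hF, hc⟩ := exists_finite_chain h'
      exact ⟨F, hF, fun _ _ => hc⟩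
    · exact ⟨∅, Set.finite_empty, fun h1 h2 => absurd ⟨h1, h2⟩ h⟩
  choose F hF hc using key
  refine ⟨⋃ θ, ⋃ ψ, ⋃ x, ⋃ y, F θ ψ x y, Set.finite_iUnion fun θ => Set.finite_iUnion fun ψ =>
    Set.finite_iUnion fun x => Set.finite_iUnion fun y => hF θ ψ x y, fun M' h hM' θ ψ hle => ?_⟩
  refine (AlgCon.gc_map_comap _ _ _).2 fun x y hxy => ?_
  have hsub : F θ ψ x y ⊆ M' := by
    refine Set.Subset.trans ?_ hM'
    exact Set.subset_iUnion_of_subset θ (Set.subset_iUnion_of_subset ψ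
      (Set.subset_iUnion_of_subset x (Set.subset_iUnion_of_subset y subset_rfl)))
  obtain ⟨_, hr⟩ := exists_rel_of_chain (φ := (inclConc h ψ).1) hsub (by
    rintro _ _ ⟨a, b, hab, rfl, rfl⟩
    exact ⟨h a.2, h b.2, (AlgCon.gc_map_comap _ ψ.1 _).1 le_rfl a b hab⟩)
    (hc θ ψ x y hle hxy) (h x.2)
  exact hr

end

variable {V : Variety L}

/-- A sequence of finite subalgebras that captures all the compact congruences. -/
theorem exists_chain (hV : IsLocallyFinite V) (A : Alg V) [Countable (Conc L A.carrier)] :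
    ∃ (N : ℕ → L.Substructure A.carrier) (hN : Monotone N), (∀ n, Finite (N n)) ∧
      (∀ n, Nonempty (N n)) ∧ (∀ θ, ∃ n ψ, subConc (N n) ψ = θ) ∧
      ∀ n θ ψ, subConc (N n) θ ≤ subConc (N n) ψ →
        inclConc (hN n.le_succ) θ ≤ inclConc (hN n.le_succ) ψ := by
  classical
  obtain ⟨e, he⟩ := exists_surjective_nat (Conc L A.carrier)
  choose F hF using fun θ : Conc L A.carrier => θ.exists_finset
  have hstep : ∀ (n : ℕ) (M : {M : L.Substructure A.carrier // Finite M}),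
      ∃ M' : {M : L.Substructure A.carrier // Finite M}, ∃ h : M.1 ≤ M'.1,
        (∀ θ ψ, subConc M.1 θ ≤ subConc M.1 ψ → inclConc h θ ≤ inclConc h ψ) ∧
        ∀ p ∈ F (e n), p.1 ∈ M'.1 ∧ p.2 ∈ M'.1 := by
    rintro n ⟨M, hM⟩
    obtain ⟨R, hR, hle⟩ := exists_finite_inclConc_le M
    -- The next subalgebra contains the witnesses for inequalities over `M` and generators of the
    -- `n`th compact congruence of `A`. The chain need not exhaust `A`; only its congruences have to
    -- be captured.
    let Y : Set A.carrier := M ∪ R ∪ ⋃ p ∈ F (e n), {p.1, p.2}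
    have hY : Y.Finite := ((Set.toFinite (M : Set A.carrier)).union hR).union
      ((F (e n)).finite_toSet.biUnion fun p _ => Set.toFinite _)
    have hsub : Y ⊆ FirstOrder.Language.Substructure.closure L Y :=
      FirstOrder.Language.Substructure.subset_closure
    refine ⟨⟨FirstOrder.Language.Substructure.closure L Y,
      hV A _ (FirstOrder.Language.Substructure.fg_closure hY)⟩,
      fun x hx => hsub (Or.inl (Or.inl hx)),
      hle _ _ fun x hx => hsub (Or.inl (Or.inr hx)), fun p hp => ?_⟩
    have : {p.1, p.2} ⊆ Y := Set.Subset.trans (Set.subset_biUnion_of_mem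
      (u := fun p : A.carrier × A.carrier => ({p.1, p.2} : Set A.carrier)) hp)
      Set.subset_union_right
    exact ⟨hsub (this (by simp)), hsub (this (by simp))⟩
  choose next hnext hle hmem using hstep
  let a : A.carrier := Classical.arbitrary _
  let N₀ : {M : L.Substructure A.carrier // Finite M} :=
    ⟨FirstOrder.Language.Substructure.closure L {a},
      hV A _ (FirstOrder.Language.Substructure.fg_closure (Set.finite_singleton a))⟩
  let N : ℕ → {M : L.Substructure A.carrier // Finite M} := fun n => Nat.rec N₀ next n
  have hmono : Monotone fun n => (N n).1 := monotone_nat_of_le_succ fun n => hnext n (N n)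
  refine ⟨fun n => (N n).1, hmono, fun n => (N n).2, fun n => ⟨⟨a, hmono (Nat.zero_le n)
    (FirstOrder.Language.Substructure.subset_closure rfl)⟩⟩, fun θ => ?_,
    fun n => hle n (N n)⟩
  obtain ⟨n, rfl⟩ := he θ
  have hm := hmem n (N n)
  refine ⟨n + 1, (F (e n)).attach.sup fun p =>
    theta L ⟨p.1.1, (hm p.1 p.2).1⟩ ⟨p.1.2, (hm p.1 p.2).2⟩, ?_⟩
  rw [map_finset_sup]
  conv_rhs => rw [hF (e n), ← Finset.sup_attach]
  exact Finset.sup_congr rfl fun p _ => Conc.map_theta _ _ _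

/-- The diagram of a chain of subalgebras. -/
def chainFunctor [L.IsAlgebraic] (A : Alg V) (N : ℕ → L.Substructure A.carrier) (hN : Monotone N)
    [∀ n, Nonempty (N n)] : ℕ ⥤ Alg V where
  obj n := A.sub (N n)
  map h := (FirstOrder.Language.Substructure.inclusion (hN h.le)).toHom

/-- The semilattice of `A` is the colimit of those of its finite subalgebras along the chain, so the
colimit of a partial lifting of that sequence represents it in `W`. -/
theorem mem_concClass_of_partialLiftings {L' : FirstOrder.Language.{u, u}} [L.IsAlgebraic]
    {W : Variety L'} (hV : IsLocallyFinite V)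
    (h : ∀ A : ℕ ⥤ Alg V, (∀ k, Finite (A.obj k)) → HasPartialLifting W (A ⋙ concFunctor V))
    (S : SemilatSupCat.{u}) (hS : S ∈ concClass V) (hc : Countable S) : S ∈ concClass W := by
  obtain ⟨A, ⟨i⟩⟩ := hS
  have hcA : Countable (Conc L A.carrier) := by
    have : Function.Injective (semFun i.hom) := Function.LeftInverse.injective (g := semFun i.inv)
      fun x => DFunLike.congr_fun (show semFun (i.hom ≫ i.inv) = SupBotHom.id _ from
        i.hom_inv_id) x
    exact this.countable
  obtain ⟨N, hN, hfin, hne, hsurj, hle⟩ := exists_chain hV A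
  obtain ⟨G, hG, ⟨j⟩⟩ := h (chainFunctor A N hN) hfin
  let jn : ∀ n, SupBotHom (G.obj n).sem (Conc L (N n)) := fun n => semFun (j.hom.app n)
  have hj : ∀ {n m} (h : n ≤ m) s, jn m (GampHom.semHom (G.map (homOfLE h)) s) =
      inclConc (hN h) (jn n s) := fun h s =>
    DFunLike.congr_fun (show semFun _ = semFun _ from j.hom.naturality (homOfLE h)) s
  have hinv : ∀ n s, semFun (j.inv.app n) (jn n s) = s := fun n s =>
    DFunLike.congr_fun (show semFun (j.hom.app n ≫ j.inv.app n) = SupBotHom.id _ from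
      j.hom_inv_id_app n) s
  have hinv' : ∀ n s, jn n (semFun (j.inv.app n) s) = s := fun n s =>
    DFunLike.congr_fun (show semFun (j.inv.app n ≫ j.hom.app n) = SupBotHom.id _ from
      j.inv_hom_id_app n) s
  let C : ColimitData W (Conc L A.carrier) :=
    { G := G
      isPartialLifting := hG
      j := fun n => (subConc (N n)).comp (jn n)
      j_map := by
        intro n m h s
        change subConc (N m) (jn m _) = subConc (N n) (jn n s)
        rw [hj, subConc_inclConc]
      exists_j_eq := by
        intro x
        obtain ⟨n, ψ, rfl⟩ := hsurj x
        exact ⟨n, semFun (j.inv.app n) ψ, congrArg (subConc (N n)) (hinv' n ψ)⟩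
      exists_le := by
        intro n s s' h
        -- By construction of the chain, an inequality that holds in `A` holds one subalgebra later.
        refine ⟨n + 1, n.le_succ, ?_⟩
        have h' := hle n (jn n s) (jn n s') h
        rw [← hj, ← hj] at h'
        have h'' := OrderHomClass.mono (semFun (j.inv.app (n + 1))) h'
        rwa [hinv, hinv] at h'' }
  obtain ⟨B, d, hd⟩ := C.exists_isConDist
  obtain ⟨χ, hχ, -⟩ := hd.exists_iso
  obtain ⟨g, hg, hg'⟩ := Function.bijective_iff_has_inverse.1 hχ
  let χ' : SupBotHom (Conc L' B.carrier) (Conc L A.carrier) :=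
    { toFun := g
      map_sup' := fun a b => hχ.1 (by rw [hg', map_sup, hg', hg'])
      map_bot' := hχ.1 (by rw [hg', map_bot]) }
  let k : (concFunctor W).obj B ≅ (concFunctor V).obj A :=
    { hom := χ'
      inv := χ
      hom_inv_id := SupBotHom.ext fun x => hg' x
      inv_hom_id := SupBotHom.ext fun x => hg x }
  exact ⟨B, ⟨k ≪≫ i⟩⟩

end Chains

/-! ### The critical point and the equivalence. -/

theorem aleph0_lt_crit_iff {L₁ L₂ : FirstOrder.Language.{u, u}} {V : Variety L₁} {W : Variety L₂} :
    ((Cardinal.aleph0 : Cardinal.{u}) : WithTop Cardinal.{u}) < crit V W ↔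
      ∀ S ∈ concClass V, Countable S → S ∈ concClass W := by
  constructor
  · intro h S hS hc
    by_contra hW
    have hle : crit V W ≤ ((Cardinal.mk S : Cardinal.{u}) : WithTop Cardinal.{u}) :=
      sInf_le ⟨S, ⟨hS, hW⟩, rfl⟩
    exact absurd h (not_lt.2 (hle.trans (WithTop.coe_le_coe.2 (Cardinal.mk_le_aleph0_iff.2 hc))))
  · intro h
    -- A strict bound on each member does not in general pass to an infimum, so the weak bound by
    -- the successor cardinal is used; it also covers an infinite critical point.
    have h1 : ((Order.succ Cardinal.aleph0 : Cardinal.{u}) : WithTop Cardinal.{u}) ≤ crit V W := by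
      refine le_sInf ?_
      rintro _ ⟨S, ⟨hS, hW⟩, rfl⟩
      refine WithTop.coe_le_coe.2 (Order.succ_le_of_lt (lt_of_not_ge fun hle => hW ?_))
      exact h S hS (Cardinal.mk_le_aleph0_iff.1 hle)
    exact lt_of_lt_of_le (WithTop.coe_lt_coe.2 (Order.lt_succ _)) h1

/-- Strict monotonicity is the right condition because the requirements on morphisms concern strict
inequalities only. -/
theorem HasPartialLifting.comp {L : FirstOrder.Language.{u, u}} {W : Variety L} {P : Type w}
    [PartialOrder P] {Q : Type v} [PartialOrder Q] {S : P ⥤ SemilatSupCat.{u}}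
    (h : HasPartialLifting W S) {f : Q → P} (hf : StrictMono f) :
    HasPartialLifting W (hf.monotone.functor ⋙ S) := by
  obtain ⟨G, hG, ⟨i⟩⟩ := h
  exact ⟨hf.monotone.functor ⋙ G, ⟨fun p => hG.strong _, fun p => hG.congruenceTractable _,
    fun p => hG.distanceGenerated _, fun p => hG.isomorphicRealization _,
    fun p q h => hG.map_strong _ _ (hf h), fun p q h => hG.map_cuttable _ _ (hf h)⟩,
    ⟨Functor.isoWhiskerLeft _ i⟩⟩

theorem isLowerFiniteTree_uLift_nat : IsLowerFiniteTree (ULift.{w} ℕ) := by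
  intro t
  refine ⟨?_, fun x _ y _ _ => le_total x y⟩
  refine Set.Finite.of_finite_image (f := ULift.down) ((Set.finite_Iic t.down).subset ?_)
    ULift.down_injective.injOn
  rintro _ ⟨s, hs, rfl⟩
  exact hs

end UA

theorem mainTheorem5 {L₁ L₂ : FirstOrder.Language.{u, u}} [L₁.IsAlgebraic] [L₂.IsAlgebraic]
    [Finite (Σ n, L₂.Functions n)] (V : UA.Variety L₁) (W : UA.Variety L₂)
    (hV : UA.IsLocallyFinite V) :
    List.TFAE [
      ((Cardinal.aleph0 : Cardinal.{u}) : WithTop Cardinal.{u}) < UA.crit V W,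
      ∀ (T : Type w) [PartialOrder T] [Countable T], UA.IsLowerFiniteTree T →
        ∀ A : T ⥤ UA.Alg V, (∀ t, Finite (A.obj t)) →
          UA.HasPartialLifting W (A ⋙ UA.concFunctor V),
      ∀ A : ℕ ⥤ UA.Alg V, (∀ k, Finite (A.obj k)) →
        UA.HasPartialLifting W (A ⋙ UA.concFunctor V)] := by
  tfae_have 1 → 2 := fun h T _ _ hT A hA =>
    UA.hasPartialLifting_of_countable hV (UA.aleph0_lt_crit_iff.1 h) hT A hA
  tfae_have 2 → 3 := by
    intro h A hA
    have hdown : Monotone (ULift.down : ULift.{w} ℕ → ℕ) := fun _ _ h => h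
    have hup : StrictMono (ULift.up : ℕ → ULift.{w} ℕ) := fun _ _ h => h
    -- The trees in the second statement live in universe `w`, so the diagram is transported to a
    -- lifted copy of the natural numbers and its lifting is restricted back.
    exact (h (ULift.{w} ℕ) UA.isLowerFiniteTree_uLift_nat (hdown.functor ⋙ A)
      fun t => hA t.down).comp hup
  tfae_have 3 → 1 := fun h =>
    UA.aleph0_lt_crit_iff.2 (UA.mem_concClass_of_partialLiftings hV h)
  tfae_finish
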